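/- **Setting.** Let $I$ be an index set with at least two elements, $B$ a unital $C^*$-algebra, and for each $\iota\in I$ let $A_\iota$ be a unital $C^*$-algebra containing a copy of $B$ as a unital $C^*$-subalgebra, with a conditional expectation $E_\iota:A_\iota\to B$ (a positive $B$-bimodule map which is the identity on $B$). Let $M_\iota=L^2(A_\iota,E_\iota)$ be the right Hilbert $B$-module obtained from $A_\iota$ by separation and completion with respect to $\langle a_1,a_2\rangle=E_\iota(a_1^*a_2)$, let $\pi_\iota:A_\iota\to\mathcal L(M_\iota)$ be the representation by left multiplication, $\xi_\iota=\widehat{1}\in M_\iota$, and $M_\iota^\circ=\{m\in M_\iota:\langle\xi_\iota,m\rangle=0\}$, which is a Hilbert $B$-$B$-bimodule via $\pi_\iota|_B$. Put $$M=\xi B\oplus\bigoplus_{n\ge1}\ \bigoplus_{\iota_1\ne\iota_2,\dots,\iota_{n-1}\ne\iota_n} M_{\iota_1}^\circ\otimes_B\cdots\otimes_B M_{\iota_n}^\circ ,$$ with $\xi=1_B$, and let $M(\iota)$ be the analogous module in which only words with $\iota_1\neq\iota$ (and the empty word) occur. Let $V_\iota:M_\iota\otimes_B M(\iota)\to M$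 be the unitary with $V_\iota(m\otimes x)=\langle\xi_\iota,m\rangle x+(m-\xi_\iota\langle\xi_\iota,m\rangle)\otimes x$, and $\lambda_\iota(a)=V_\iota(\pi_\iota(a)\otimes1)V_\iota^*\in\mathcal L(M)$ for $a\in A_\iota$. The reduced amalgamated free product $(A,E)=*_{\iota\in I}(A_\iota,E_\iota)$ consists of the $C^*$-subalgebra $A\subseteq\mathcal L(M)$ generated by $\bigcup_\iota\lambda_\iota(A_\iota)$ and the map $E:A\to B$, $E(x)=\langle\xi,x\xi\rangle$. A positive linear map $F$ on a $C^*$-algebra is called faithful if $F(a^*a)=0$ implies $a=0$. **Theorem (Ricard).** If every $E_\iota$ is faithful, then $E$ is faithful. **Consequence.** Let $\varphi_B$ be a linear functional on $B$ and let $\varphi_\iota$ be states on $A_\iota$ ($\iota\in I$) with $\varphi_\iota=\varphi_\iota\circ E_\iota$ and $\varphi_\iota|_B=\varphi_B$ for all $\iota\in I$. If every $\varphi_\iota$ is faithful, then the free product state $\varphi=\varphi_B\circ E$ on $A$ is faithful. -/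

import Mathlib

universe u v w

namespace FreeProd

open scoped ComplexOrder TensorProduct
open MulOpposite

noncomputable section

set_option linter.unusedSectionVars false
set_option linter.unusedVariables false

/-! ### Semi-inner products -/

section SemiInner

variable (B : Type u) [CStarAlgebra B] [PartialOrder B] [StarOrderedRing B]

/-- A `B`-valued semi-inner product on a right `B`-module `V` (right modules over `B` are modules
over `Bᵐᵒᵖ`); it is linear in the second variable. -/
structure SemiInner (V : Type v) [AddCommGroup V] [Module ℂ V] [Module Bᵐᵒᵖ V] where
  form : V → V → B
  add_right : ∀ x y z, form x (y + z) = form x y + form x z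
  smul_right : ∀ (c : ℂ) x y, form x (c • y) = c • form x y
  rsmul_right : ∀ (b : B) x y, form x (op b • y) = form x y * b
  star_form : ∀ x y, star (form x y) = form y x
  self_nonneg : ∀ x, 0 ≤ form x x

variable {B} {V : Type v} [AddCommGroup V] [Module ℂ V] [Module Bᵐᵒᵖ V] (s : SemiInner B V)

namespace SemiInner

lemma add_left (x y z : V) : s.form (x + y) z = s.form x z + s.form y z := by
  rw [← s.star_form, s.add_right, star_add, s.star_form, s.star_form]

lemma smul_left (c : ℂ) (x y : V) : s.form (c • x) y = star c • s.form x y := by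
  rw [← s.star_form, s.smul_right, star_smul, s.star_form]

lemma rsmul_left (b : B) (x y : V) : s.form (op b • x) y = star b * s.form x y := by
  rw [← s.star_form, s.rsmul_right, star_mul, s.star_form]

lemma neg_right (x y : V) : s.form x (-y) = - s.form x y := by
  have := s.smul_right (-1) x y
  simpa using this

lemma neg_left (x y : V) : s.form (-x) y = - s.form x y := by
  have := s.smul_left (-1) x y
  simpa using this

lemma sub_right (x y z : V) : s.form x (y - z) = s.form x y - s.form x z := by
  rw [sub_eq_add_neg, s.add_right, s.neg_right, sub_eq_add_neg]

lemma sub_left (x y z : V) : s.form (x - y) z = s.form x z - s.form y z := by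
  rw [sub_eq_add_neg, s.add_left, s.neg_left, sub_eq_add_neg]

lemma zero_right (x : V) : s.form x 0 = 0 := by
  have := s.smul_right 0 x 0
  simpa using this

lemma zero_left (x : V) : s.form 0 x = 0 := by
  have := s.smul_left 0 0 x
  simpa using this

/-- The semi-inner product as a sesquilinear map. -/
def sesq : V →ₗ⋆[ℂ] V →ₗ[ℂ] B :=
  LinearMap.mk₂'ₛₗ (starRingEnd ℂ) (RingHom.id ℂ) s.form s.add_left s.smul_left s.add_right
    s.smul_right

@[simp] lemma sesq_apply (x y : V) : s.sesq x y = s.form x y := rfl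

/-- The Cauchy-Schwarz inequality. -/
lemma norm_form_sq_le (x y : V) : ‖s.form x y‖ ^ 2 ≤ ‖s.form x x‖ * ‖s.form y y‖ := by
  set a := s.form x y with ha
  have key : ∀ t : ℝ, ‖s.form x x‖ < t → ‖a‖ ^ 2 ≤ t * ‖s.form y y‖ := by
    intro t ht
    have ht0 : 0 < t := (norm_nonneg _).trans_lt ht
    have h1 := s.self_nonneg (op a • x - (t : ℂ) • y)
    have h2 : star a * s.form x x * a ≤ t • (star a * a) := by
      refine (CStarAlgebra.star_left_conjugate_le_norm_smul
        (hb := s.star_form x x)).trans ?_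
      exact smul_le_smul_of_nonneg_right ht.le (star_mul_self_nonneg a)
    have h3 : s.form (op a • x - (t : ℂ) • y) (op a • x - (t : ℂ) • y)
        = star a * s.form x x * a - t • (star a * a) - t • (star a * a)
          + t • t • s.form y y := by
      have hr : ∀ x y : V, s.form x ((t : ℂ) • y) = t • s.form x y := fun x y => by
        rw [s.smul_right, Complex.coe_smul]
      have hl : ∀ x y : V, s.form ((t : ℂ) • x) y = t • s.form x y := fun x y => by
        rw [s.smul_left, Complex.star_def, Complex.conj_ofReal, Complex.coe_smul]
      rw [s.sub_right, s.sub_left, s.sub_left, s.rsmul_right, s.rsmul_left, s.rsmul_right, hr, hl,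
        hr, hl, s.rsmul_left, ← s.star_form x y, ← ha, smul_mul_assoc]
      abel
    rw [h3] at h1
    have h4 : t • (star a * a) ≤ t • t • s.form y y := by
      rw [← sub_nonneg]
      have h5 := add_nonneg h1 (sub_nonneg.2 h2)
      refine h5.trans_eq ?_
      abel
    have h5 := CStarAlgebra.norm_le_norm_of_nonneg_of_le
      (smul_nonneg ht0.le (star_mul_self_nonneg a)) h4
    rw [norm_smul, norm_smul, norm_smul, CStarRing.norm_star_mul_self,
      Real.norm_of_nonneg ht0.le] at h5
    have := le_of_mul_le_mul_left h5 ht0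
    rwa [pow_two]
  refine le_of_forall_pos_le_add fun ε hε => ?_
  have hy : 0 ≤ ‖s.form y y‖ := norm_nonneg _
  have := key (‖s.form x x‖ + ε / (‖s.form y y‖ + 1)) (by
    have : 0 < ε / (‖s.form y y‖ + 1) := by positivity
    linarith)
  refine this.trans ?_
  rw [add_mul]
  gcongr
  rw [div_mul_eq_mul_div, div_le_iff₀ (by positivity)]
  nlinarith

/-- The type `V` equipped with the seminorm `‖x‖ = ‖⟨x, x⟩‖ ^ (1/2)`. -/
@[nolint unusedArguments]
def Space (_ : SemiInner B V) : Type v := V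

instance : AddCommGroup s.Space := inferInstanceAs (AddCommGroup V)
instance : Module ℂ s.Space := inferInstanceAs (Module ℂ V)
instance : Module Bᵐᵒᵖ s.Space := inferInstanceAs (Module Bᵐᵒᵖ V)

instance : Norm s.Space := ⟨fun x => √‖s.form x x‖⟩

lemma norm_def (x : s.Space) : ‖x‖ = √‖s.form x x‖ := rfl

lemma norm_sq (x : s.Space) : ‖x‖ ^ 2 = ‖s.form x x‖ := by
  rw [norm_def, Real.sq_sqrt (norm_nonneg _)]

lemma norm_form_le (x y : s.Space) : ‖s.form x y‖ ≤ ‖x‖ * ‖y‖ := by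
  rw [norm_def, norm_def, ← Real.sqrt_mul (norm_nonneg _)]
  exact Real.le_sqrt_of_sq_le (s.norm_form_sq_le x y)

lemma core : SeminormedSpace.Core ℂ s.Space where
  norm_nonneg _ := Real.sqrt_nonneg _
  norm_smul c x := by
    change √‖s.form (c • (show V from x)) (c • (show V from x))‖ = ‖c‖ * √‖s.form x x‖
    rw [s.smul_left, s.smul_right, smul_smul, norm_smul, norm_mul, norm_star, Real.sqrt_mul (by positivity),
      Real.sqrt_mul_self (norm_nonneg _)]
  norm_triangle x y := by
    have h : ∀ x y : V, s.form (x + y) (x + y)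
        = s.form x x + s.form x y + s.form y x + s.form y y := by
      intro x y
      rw [s.add_left, s.add_right, s.add_right]; abel
    have hx : 0 ≤ ‖x‖ := Real.sqrt_nonneg _
    have hy : 0 ≤ ‖y‖ := Real.sqrt_nonneg _
    refine Real.sqrt_le_iff.2 ⟨add_nonneg hx hy, ?_⟩
    change ‖s.form ((show V from x) + (show V from y)) ((show V from x) + (show V from y))‖ ≤ _
    rw [h]
    have h1 := norm_add_le (s.form x x + s.form x y + s.form y x) (s.form y y)
    have h2 := norm_add_le (s.form x x + s.form x y) (s.form y x)
    have h3 := norm_add_le (s.form x x) (s.form x y)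
    have h4 := s.norm_form_le x y
    have h5 := s.norm_form_le y x
    rw [← s.norm_sq x] at h3
    rw [← s.norm_sq y] at h1
    nlinarith

instance : SeminormedAddCommGroup s.Space := SeminormedAddCommGroup.ofCore s.core
instance : NormedSpace ℂ s.Space := { norm_smul_le := fun c x => (s.core.norm_smul c x).le }

lemma norm_rsmul_le (b : Bᵐᵒᵖ) (x : s.Space) : ‖b • x‖ ≤ ‖unop b‖ * ‖x‖ := by
  have h : ∀ x : V, s.form (b • x) (b • x) = star (unop b) * s.form x x * unop b := by
    intro x
    obtain ⟨b, rfl⟩ := op_surjective b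
    rw [s.rsmul_left, s.rsmul_right, unop_op, mul_assoc]
  refine Real.sqrt_le_iff.2 ⟨by positivity, ?_⟩
  change ‖s.form (b • (show V from x)) (b • (show V from x))‖ ≤ _
  rw [h, mul_pow, s.norm_sq]
  have h1 := norm_mul_le (star (unop b) * s.form x x) (unop b)
  have h2 := norm_mul_le (star (unop b)) (s.form x x)
  rw [norm_star] at h2
  nlinarith [norm_nonneg (unop b)]

instance : UniformContinuousConstSMul Bᵐᵒᵖ s.Space where
  uniformContinuous_const_smul b := by
    let f : s.Space →+ s.Space := DistribSMul.toAddMonoidHom s.Space b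
    exact (AddMonoidHomClass.lipschitz_of_bound f ‖unop b‖
      (fun x => s.norm_rsmul_le b x)).uniformContinuous

end SemiInner
end SemiInner

section HilbertModule

variable (B : Type u) [CStarAlgebra B] [PartialOrder B] [StarOrderedRing B]

/-- A right Hilbert `B`-module. -/
structure HilbertModule where
  carrier : Type v
  [normedAddCommGroup : NormedAddCommGroup carrier]
  [normedSpace : NormedSpace ℂ carrier]
  [completeSpace : CompleteSpace carrier]
  [rightModule : Module Bᵐᵒᵖ carrier]
  inner : SemiInner B carrier
  norm_sq : ∀ x, ‖x‖ ^ 2 = ‖inner.form x x‖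

variable {B}

namespace HilbertModule

instance : CoeSort (HilbertModule.{u, v} B) (Type v) := ⟨carrier⟩

attribute [instance] normedAddCommGroup normedSpace completeSpace rightModule

section
variable (X : HilbertModule.{u, v} B)

/-- The `B`-valued inner product of a Hilbert module. -/
abbrev ip (x y : X) : B := X.inner.form x y

lemma norm_ip_le (x y : X) : ‖X.ip x y‖ ≤ ‖x‖ * ‖y‖ := by
  refine le_of_sq_le_sq ?_ (by positivity)
  rw [mul_pow, X.norm_sq, X.norm_sq]
  exact X.inner.norm_form_sq_le x y

lemma eq_zero_of_ip {x : X} (h : ∀ y, X.ip y x = 0) : x = 0 := by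
  have := X.norm_sq x
  rw [show X.inner.form x x = 0 from h x, norm_zero] at this
  simpa using this

lemma ext_ip {x y : X} (h : ∀ z, X.ip z x = X.ip z y) : x = y := by
  rw [← sub_eq_zero]
  refine X.eq_zero_of_ip fun z => ?_
  rw [ip, X.inner.sub_right, sub_eq_zero]
  exact h z

lemma ext_ip_left {x y : X} (h : ∀ z, X.ip x z = X.ip y z) : x = y :=
  X.ext_ip fun z => by rw [ip, ip, ← X.inner.star_form x z, ← X.inner.star_form y z]; exact congrArg star (h z)

instance : SMulCommClass Bᵐᵒᵖ ℂ X where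
  smul_comm b c x := by
    obtain ⟨b, rfl⟩ := op_surjective b
    refine X.ext_ip fun z => ?_
    simp only [ip, X.inner.rsmul_right, X.inner.smul_right, smul_mul_assoc]

lemma continuous_ip : Continuous fun p : X × X => X.ip p.1 p.2 := by
  let f : X →L⋆[ℂ] X →L[ℂ] B := LinearMap.mkContinuous₂ X.inner.sesq 1 fun x y => by
    simpa using X.norm_ip_le x y
  change Continuous fun p : X × X => f p.1 p.2
  fun_prop

end

end HilbertModule

namespace SemiInner

variable {V : Type v} [AddCommGroup V] [Module ℂ V] [Module Bᵐᵒᵖ V] (s : SemiInner B V)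

lemma continuous_form : Continuous fun p : s.Space × s.Space => s.form p.1 p.2 := by
  let g : s.Space →ₗ⋆[ℂ] s.Space →ₗ[ℂ] B := s.sesq
  let f : s.Space →L⋆[ℂ] s.Space →L[ℂ] B := LinearMap.mkContinuous₂ g 1 fun x y => by
    rw [one_mul]; exact s.norm_form_le x y
  change Continuous fun p : s.Space × s.Space => f p.1 p.2
  fun_prop

/-- The Hausdorff completion of `V`. -/
abbrev Compl : Type v := UniformSpace.Completion s.Space

/-- The canonical map from `V` into its Hausdorff completion. -/
def toCompl : V →ₗ[ℂ] s.Compl :=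
  (UniformSpace.Completion.toComplL (𝕜 := ℂ) (E := s.Space)).toLinearMap

lemma denseRange_toCompl : DenseRange s.toCompl :=
  UniformSpace.Completion.denseRange_coe (α := s.Space)

lemma norm_toCompl_sq (x : V) : ‖s.toCompl x‖ ^ 2 = ‖s.form x x‖ := by
  rw [← s.norm_sq x]
  congr 1
  exact UniformSpace.Completion.norm_coe (E := s.Space) x

lemma toCompl_rsmul (b : Bᵐᵒᵖ) (x : V) : s.toCompl (b • x) = b • s.toCompl x :=
  UniformSpace.Completion.coe_smul (X := s.Space) b x

/-- The extension of the semi-inner product to the completion. -/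
def complForm (x y : s.Compl) : B :=
  ((UniformSpace.Completion.isDenseInducing_coe (α := s.Space)).prodMap
    (UniformSpace.Completion.isDenseInducing_coe (α := s.Space))).extend
      (fun p : s.Space × s.Space => s.form p.1 p.2) (x, y)

lemma complForm_coe (x y : V) : s.complForm (s.toCompl x) (s.toCompl y) = s.form x y :=
  ((UniformSpace.Completion.isDenseInducing_coe (α := s.Space)).prodMap
    (UniformSpace.Completion.isDenseInducing_coe (α := s.Space))).extend_eq
      s.continuous_form (x, y)

lemma continuous_complForm : Continuous fun p : s.Compl × s.Compl => s.complForm p.1 p.2 := by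
  let g : s.Space →+ s.Space →+ B :=
    { toFun := fun x => ((s.sesq x : V →ₗ[ℂ] B).toAddMonoidHom : s.Space →+ B)
      map_zero' := by ext x; exact s.zero_left x
      map_add' := fun x y => by ext z; exact s.add_left _ _ _ }
  have : Continuous fun p : s.Space × s.Space => g p.1 p.2 := s.continuous_form
  exact (UniformSpace.Completion.isDenseInducing_toCompl s.Space).extend_Z_bilin
    (UniformSpace.Completion.isDenseInducing_toCompl s.Space) this

@[fun_prop]
lemma complForm_continuous {α : Type*} [TopologicalSpace α] {f g : α → s.Compl}
    (hf : Continuous f) (hg : Continuous g) : Continuous fun a => s.complForm (f a) (g a) :=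
  s.continuous_complForm.comp (hf.prodMk hg)

lemma compl_ind {p : s.Compl → Prop} (x : s.Compl) (hp : IsClosed {x | p x})
    (h : ∀ v : V, p (s.toCompl v)) : p x :=
  UniformSpace.Completion.induction_on x hp h

lemma complForm_add_right (x y z : s.Compl) :
    s.complForm x (y + z) = s.complForm x y + s.complForm x z := by
  induction x using s.compl_ind with
  | hp => exact isClosed_eq (by fun_prop) (by fun_prop)
  | h x =>
  induction y using s.compl_ind with
  | hp => exact isClosed_eq (by fun_prop) (by fun_prop)
  | h y =>
  induction z using s.compl_ind with
  | hp => exact isClosed_eq (by fun_prop) (by fun_prop)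
  | h z =>
  rw [← map_add, complForm_coe, complForm_coe, complForm_coe, s.add_right]

lemma complForm_smul_right (c : ℂ) (x y : s.Compl) :
    s.complForm x (c • y) = c • s.complForm x y := by
  induction x using s.compl_ind with
  | hp => exact isClosed_eq (by fun_prop) (by fun_prop)
  | h x =>
  induction y using s.compl_ind with
  | hp => exact isClosed_eq (s.complForm_continuous continuous_const (continuous_const_smul c))
            ((s.complForm_continuous continuous_const continuous_id).const_smul c)
  | h y =>
  rw [← s.toCompl.map_smul c y, complForm_coe, complForm_coe, s.smul_right]

lemma complForm_rsmul_right (b : B) (x y : s.Compl) :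
    s.complForm x (op b • y) = s.complForm x y * b := by
  induction x using s.compl_ind with
  | hp => exact isClosed_eq (by fun_prop) (by fun_prop)
  | h x =>
  induction y using s.compl_ind with
  | hp => exact isClosed_eq (s.complForm_continuous continuous_const (continuous_const_smul (op b)))
            ((s.complForm_continuous continuous_const continuous_id).mul continuous_const)
  | h y =>
  rw [← s.toCompl_rsmul (op b) y, complForm_coe, complForm_coe, s.rsmul_right]

lemma star_complForm (x y : s.Compl) : star (s.complForm x y) = s.complForm y x := by
  induction x using s.compl_ind with
  | hp => exact isClosed_eq (by fun_prop) (by fun_prop)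
  | h x =>
  induction y using s.compl_ind with
  | hp => exact isClosed_eq (by fun_prop) (by fun_prop)
  | h y =>
  rw [complForm_coe, complForm_coe, s.star_form]

lemma complForm_self_nonneg (x : s.Compl) : 0 ≤ s.complForm x x := by
  have hc : Continuous fun x => s.complForm x x := by fun_prop
  refine s.compl_ind x (CStarAlgebra.isClosed_nonneg.preimage hc) fun x => ?_
  change 0 ≤ s.complForm (s.toCompl x) (s.toCompl x)
  rw [complForm_coe]
  exact s.self_nonneg x

lemma norm_sq_compl (x : s.Compl) : ‖x‖ ^ 2 = ‖s.complForm x x‖ := by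
  induction x using s.compl_ind with
  | hp => exact isClosed_eq (by fun_prop) (by fun_prop)
  | h x =>
  rw [complForm_coe, norm_toCompl_sq]

/-- The right Hilbert `B`-module obtained from a semi-inner product module by separation and
completion. -/
def hilbert : HilbertModule.{u, v} B where
  carrier := s.Compl
  inner :=
    { form := s.complForm
      add_right := s.complForm_add_right
      smul_right := s.complForm_smul_right
      rsmul_right := s.complForm_rsmul_right
      star_form := s.star_complForm
      self_nonneg := s.complForm_self_nonneg }
  norm_sq := s.norm_sq_compl

/-- The canonical map from `V` to its completion, as a Hilbert module. -/
def toHilbert : V →ₗ[ℂ] s.hilbert := s.toCompl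

lemma denseRange_toHilbert : DenseRange s.toHilbert := s.denseRange_toCompl

lemma ip_toHilbert (x y : V) : s.hilbert.ip (s.toHilbert x) (s.toHilbert y) = s.form x y :=
  s.complForm_coe x y

lemma toHilbert_rsmul (b : Bᵐᵒᵖ) (x : V) : s.toHilbert (b • x) = b • s.toHilbert x :=
  s.toCompl_rsmul b x

lemma norm_toHilbert_sq (x : V) : ‖s.toHilbert x‖ ^ 2 = ‖s.form x x‖ := s.norm_toCompl_sq x

lemma hilbert_ind {p : s.hilbert → Prop} (x : s.hilbert) (hp : IsClosed {x | p x})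
    (h : ∀ v : V, p (s.toHilbert v)) : p x := s.compl_ind x hp h

end SemiInner
end HilbertModule

section Adjointable

variable {B : Type u} [CStarAlgebra B] [PartialOrder B] [StarOrderedRing B]

/-- The algebra `𝓛(X)` of adjointable operators on a Hilbert module, as a subalgebra of the bounded
operators (with the operator norm). -/
def Adj (X : HilbertModule.{u, v} B) : Subalgebra ℂ (X →L[ℂ] X) where
  carrier := {T | ∃ S : X →L[ℂ] X, ∀ x y, X.ip (T x) y = X.ip x (S y)}
  mul_mem' := by
    rintro T T' ⟨S, h⟩ ⟨S', h'⟩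
    exact ⟨S' * S, fun x y => by simp [h, h']⟩
  add_mem' := by
    rintro T T' ⟨S, h⟩ ⟨S', h'⟩
    refine ⟨S + S', fun x y => ?_⟩
    simp [HilbertModule.ip] at h h' ⊢
    rw [X.inner.add_left, X.inner.add_right, h, h']
  algebraMap_mem' := by
    refine fun c => ⟨algebraMap ℂ _ (star c), fun x y => ?_⟩
    simp [HilbertModule.ip, Algebra.algebraMap_eq_smul_one, X.inner.smul_left,
      X.inner.smul_right]

namespace Adj

variable {X : HilbertModule.{u, v} B}

lemma ext_apply {S T : Adj X} (h : ∀ x, S.1 x = T.1 x) : S = T :=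
  Subtype.ext (ContinuousLinearMap.ext h)

/-- The adjoint of an adjointable operator. -/
instance : Star (Adj X) where
  star T := ⟨T.2.choose, T.1, fun x y => by
    exact (X.inner.star_form _ _).symm.trans
      ((congrArg star (T.2.choose_spec y x).symm).trans (X.inner.star_form _ _))⟩

lemma ip_star_right (T : Adj X) (x y : X) : X.ip x ((star T).1 y) = X.ip (T.1 x) y :=
  (T.2.choose_spec x y).symm

lemma ip_star_left (T : Adj X) (x y : X) : X.ip ((star T).1 x) y = X.ip x (T.1 y) := by
  rw [HilbertModule.ip, ← X.inner.star_form]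
  refine (congrArg star (ip_star_right T y x)).trans ?_
  exact X.inner.star_form _ _

lemma star_eq_of {S T : Adj X} (h : ∀ x y, X.ip (T.1 x) y = X.ip x (S.1 y)) : star T = S :=
  ext_apply fun y => X.ext_ip fun x => by rw [ip_star_right, h]

instance : StarRing (Adj X) where
  star_involutive T := star_eq_of fun x y => ip_star_left T x y
  star_mul S T := star_eq_of fun x y => by
    change X.ip (S.1 (T.1 x)) y = X.ip x ((star T).1 ((star S).1 y))
    rw [ip_star_right, ip_star_right]
  star_add S T := star_eq_of fun x y => by
    change X.inner.form (S.1 x + T.1 x) y = X.inner.form x ((star S).1 y + (star T).1 y)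
    rw [X.inner.add_left, X.inner.add_right]
    exact congrArg₂ _ (ip_star_right S x y).symm (ip_star_right T x y).symm

instance : StarModule ℂ (Adj X) where
  star_smul c T := star_eq_of fun x y => by
    change X.inner.form (c • T.1 x) y = X.inner.form x (star c • (star T).1 y)
    rw [X.inner.smul_left, X.inner.smul_right]
    exact congrArg _ (ip_star_right T x y).symm

lemma norm_apply_sq_le (T : Adj X) (x : X) : ‖T.1 x‖ ^ 2 ≤ ‖(star T * T).1‖ * ‖x‖ ^ 2 := by
  rw [X.norm_sq]
  have h : X.ip x ((star T * T).1 x) = X.ip (T.1 x) (T.1 x) := ip_star_right T x (T.1 x)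
  calc ‖X.ip (T.1 x) (T.1 x)‖ = ‖X.ip x ((star T * T).1 x)‖ := by rw [h]
    _ ≤ ‖x‖ * ‖(star T * T).1 x‖ := X.norm_ip_le _ _
    _ ≤ ‖x‖ * (‖(star T * T).1‖ * ‖x‖) := by
        gcongr; exact ContinuousLinearMap.le_opNorm _ _
    _ = _ := by ring

instance : CStarRing (Adj X) where
  norm_mul_self_le T := by
    have h : ‖T.1‖ ≤ √‖(star T * T).1‖ := by
      refine ContinuousLinearMap.opNorm_le_bound _ (Real.sqrt_nonneg _) fun x => ?_
      refine le_of_sq_le_sq ?_ (by positivity)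
      rw [mul_pow, Real.sq_sqrt (norm_nonneg _)]
      exact norm_apply_sq_le T x
    have := mul_self_le_mul_self (norm_nonneg _) h
    rwa [Real.mul_self_sqrt (norm_nonneg _)] at this

lemma isClosed_coe : IsClosed (Adj X : Set (X →L[ℂ] X)) := by
  refine isClosed_of_closure_subset fun T hT => ?_
  obtain ⟨t, ht, hlim⟩ := mem_closure_iff_seq_limit.1 hT
  let t' : ℕ → Adj X := fun n => ⟨t n, ht n⟩
  have hc : CauchySeq (fun n => (star (t' n)).1) := by
    have h1 : CauchySeq t := hlim.cauchySeq
    rw [Metric.cauchySeq_iff] at h1 ⊢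
    intro ε hε
    obtain ⟨N, hN⟩ := h1 ε hε
    refine ⟨N, fun m hm n hn => ?_⟩
    have h2 := hN m hm n hn
    rw [dist_eq_norm] at h2 ⊢
    have h3 : ‖star (t' m - t' n)‖ = ‖t' m - t' n‖ := norm_star (t' m - t' n)
    rw [star_sub] at h3
    exact lt_of_eq_of_lt h3 h2
  obtain ⟨S, hS⟩ := cauchySeq_tendsto_of_complete hc
  refine ⟨S, fun x y => ?_⟩
  have h1 : Filter.Tendsto (fun n => X.ip (t n x) y) Filter.atTop (nhds (X.ip (T x) y)) :=
    (X.continuous_ip.tendsto (T x, y)).comp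
      ((((ContinuousLinearMap.apply ℂ X x).continuous.tendsto T).comp hlim).prodMk_nhds
        tendsto_const_nhds)
  have h2 : Filter.Tendsto (fun n => X.ip x ((star (t' n)).1 y)) Filter.atTop
      (nhds (X.ip x (S y))) :=
    (X.continuous_ip.tendsto (x, S y)).comp
      (tendsto_const_nhds.prodMk_nhds
        (((ContinuousLinearMap.apply ℂ X y).continuous.tendsto S).comp hS))
  refine tendsto_nhds_unique h1 (h2.congr fun n => ?_)
  exact ip_star_right (t' n) x y

instance : CompleteSpace (Adj X) := isClosed_coe.completeSpace_coe

instance : CStarAlgebra (Adj X) where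

end Adj
end Adjointable

section Constructions

variable {B : Type u} [CStarAlgebra B] [PartialOrder B] [StarOrderedRing B]

lemma exists_pos_neg {R : Type*} [CStarAlgebra R] {G : R} (hG : IsSelfAdjoint G) :
    ∃ p c N : R, G = p - N ∧ N * p = 0 ∧ star N = N ∧ N = star c * c ∧
      (N = 0 → ∃ Y, G = star Y * Y) := by
  let _ := CStarAlgebra.spectralOrder R
  have _ := CStarAlgebra.spectralOrderedRing R
  have hN : 0 ≤ G⁻ := CFC.negPart_nonneg G
  obtain ⟨c, hc⟩ := CStarAlgebra.nonneg_iff_eq_star_mul_self.1 hN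
  refine ⟨G⁺, c, G⁻, (CFC.posPart_sub_negPart G hG).symm, CFC.negPart_mul_posPart G,
    (IsSelfAdjoint.of_nonneg hN).star_eq, hc, fun h => ?_⟩
  exact CStarAlgebra.nonneg_iff_eq_star_mul_self.1 ((CFC.negPart_eq_zero_iff G hG).1 h)

namespace SemiInner

variable {V : Type v} [AddCommGroup V] [Module ℂ V] [Module Bᵐᵒᵖ V] (s : SemiInner B V)

lemma sum_right {ι : Type*} (t : Finset ι) (x : V) (y : ι → V) :
    s.form x (∑ i ∈ t, y i) = ∑ i ∈ t, s.form x (y i) :=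
  map_sum (s.sesq x) y t

lemma sum_left {ι : Type*} (t : Finset ι) (x : ι → V) (y : V) :
    s.form (∑ i ∈ t, x i) y = ∑ i ∈ t, s.form (x i) y := by
  rw [← s.star_form, s.sum_right, star_sum]
  exact Finset.sum_congr rfl fun i _ => s.star_form _ _

/-- Gram matrices are positive. -/
lemma exists_gram {n : Type*} [Fintype n] [DecidableEq n] (x : n → V) :
    ∃ Y : n → n → B, ∀ i j, s.form (x i) (x j) = ∑ k, star (Y k i) * Y k j := by
  let G : CStarMatrix n n B := CStarMatrix.ofMatrix fun i j => s.form (x i) (x j)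
  have hG : IsSelfAdjoint G := by
    refine CStarMatrix.ext fun i j => ?_
    rw [CStarMatrix.star_apply]
    exact s.star_form _ _
  obtain ⟨p, c, N, h1, h2, hNs, hc, hfin⟩ := exists_pos_neg hG
  have hGN : N * G * N = -(N * N * N) := by
    have h3 : N * G = -(N * N) := by
      conv_lhs => rw [h1]
      rw [mul_sub, h2, zero_sub]
    rw [h3, neg_mul]
  let d : CStarMatrix n n B := c * N
  have hd : N * N * N = star d * d := by
    change _ = star (c * N) * (c * N)
    rw [star_mul, hNs]
    conv_lhs => rw [mul_assoc, show N * N = star c * c * N by rw [← hc]]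
    simp only [mul_assoc]
  have hd0 : d = 0 := by
    have hdiag : ∀ k, ∑ i, star (d i k) * d i k = 0 := by
      intro k
      have h1 : (star d * d) k k = ∑ i, star (d i k) * d i k := by
        rw [CStarMatrix.mul_apply]
        exact Finset.sum_congr rfl fun i _ => by rw [CStarMatrix.star_apply]
      have h2 : (N * G * N) k k
          = s.form (∑ i, op (N i k) • x i) (∑ j, op (N j k) • x j) := by
        rw [s.sum_right, CStarMatrix.mul_apply]
        refine Finset.sum_congr rfl fun j _ => ?_
        rw [s.rsmul_right, s.sum_left, CStarMatrix.mul_apply]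
        refine congrArg (· * _) (Finset.sum_congr rfl fun i _ => ?_)
        rw [s.rsmul_left, ← CStarMatrix.star_apply, hNs]
        rfl
      refine le_antisymm ?_ (Finset.sum_nonneg fun i _ => star_mul_self_nonneg _)
      rw [← h1, ← hd, ← neg_nonneg]
      have h3 : -(N * N * N) k k = (N * G * N) k k := by rw [hGN]; rfl
      rw [h3, h2]
      exact s.self_nonneg _
    refine CStarMatrix.ext fun i k => ?_
    have := (Finset.sum_eq_zero_iff_of_nonneg
      (fun i _ => star_mul_self_nonneg (d i k))).1 (hdiag k) i (Finset.mem_univ i)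
    exact CStarRing.star_mul_self_eq_zero_iff _ |>.1 this
  have hN0 : N = 0 := by
    have h3 : N * N * N = 0 := by rw [hd, hd0, mul_zero]
    have h4 : star (N * N) * (N * N) = 0 := by
      rw [star_mul, hNs, ← mul_assoc, h3, zero_mul]
    have h2 : star N * N = 0 := by
      rw [hNs]; exact (CStarRing.star_mul_self_eq_zero_iff _).1 h4
    exact (CStarRing.star_mul_self_eq_zero_iff _).1 h2
  obtain ⟨Y, hY⟩ := hfin hN0
  refine ⟨fun k j => Y k j, fun i j => ?_⟩
  have : G i j = (star Y * Y) i j := by rw [← hY]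
  rw [CStarMatrix.mul_apply] at this
  exact this.trans (Finset.sum_congr rfl fun k _ => by rw [CStarMatrix.star_apply])

section liftRep

variable {K : Type w} [CStarAlgebra K] (ρ : K →ₐ[ℂ] Module.End ℂ V)
  (hρ : ∀ k x y, s.form (ρ k x) y = s.form x (ρ (star k) y))

lemma norm_rep_le (hρ : ∀ k x y, s.form (ρ k x) y = s.form x (ρ (star k) y))
    (k : K) (x : V) : ‖s.toHilbert (ρ k x)‖ ≤ ‖k‖ * ‖s.toHilbert x‖ := by
  let _ := CStarAlgebra.spectralOrder K
  have _ := CStarAlgebra.spectralOrderedRing K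
  have h1 : 0 ≤ algebraMap ℝ K (‖k‖ ^ 2) - star k * k :=
    sub_nonneg.2 CStarAlgebra.star_mul_le_algebraMap_norm_sq
  obtain ⟨c, hc⟩ := CStarAlgebra.nonneg_iff_eq_star_mul_self.1 h1
  have h2 : ∀ l : K, s.form (ρ l x) (ρ l x) = s.form x (ρ (star l * l) x) := fun l => by
    rw [hρ, map_mul]; rfl
  have h3 : s.form (ρ c x) (ρ c x) = (‖k‖ ^ 2) • s.form x x - s.form (ρ k x) (ρ k x) := by
    have h4 : algebraMap ℝ K (‖k‖ ^ 2) = algebraMap ℂ K ((‖k‖ ^ 2 : ℝ) : ℂ) := by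
      rw [Algebra.algebraMap_eq_smul_one, Algebra.algebraMap_eq_smul_one, Complex.coe_smul]
    rw [h2, h2, ← hc, map_sub, h4, AlgHom.commutes, LinearMap.sub_apply, s.sub_right,
      Module.algebraMap_end_apply, s.smul_right, Complex.coe_smul]
  have h5 : s.form (ρ k x) (ρ k x) ≤ (‖k‖ ^ 2) • s.form x x := by
    rw [← sub_nonneg, ← h3]; exact s.self_nonneg _
  have h6 := CStarAlgebra.norm_le_norm_of_nonneg_of_le (s.self_nonneg _) h5
  refine le_of_sq_le_sq ?_ (by positivity)
  rw [mul_pow, norm_toHilbert_sq, norm_toHilbert_sq]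
  rwa [norm_smul, Real.norm_of_nonneg (by positivity)] at h6

/-- The extension to the completion of an operator of a `*`-representation. -/
def repL (k : K) : s.hilbert →L[ℂ] s.hilbert :=
  (s.toHilbert ∘ₗ ρ k).extendOfNorm s.toHilbert

lemma repL_apply (hρ : ∀ k x y, s.form (ρ k x) y = s.form x (ρ (star k) y))
    (k : K) (x : V) : s.repL ρ k (s.toHilbert x) = s.toHilbert (ρ k x) :=
  LinearMap.extendOfNorm_eq s.denseRange_toHilbert ⟨‖k‖, fun x => s.norm_rep_le ρ hρ k x⟩ x

lemma clm_ext {F : Type*} [NormedAddCommGroup F] [NormedSpace ℂ F] {S T : s.hilbert →L[ℂ] F}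
    (h : ∀ x, S (s.toHilbert x) = T (s.toHilbert x)) : S = T := by
  exact ContinuousLinearMap.ext fun x =>
    s.hilbert_ind (p := fun x => S x = T x) x (isClosed_eq S.continuous T.continuous) h

lemma repL_adj (hρ : ∀ k x y, s.form (ρ k x) y = s.form x (ρ (star k) y))
    (k : K) (x y : s.hilbert) :
    s.hilbert.ip (s.repL ρ k x) y = s.hilbert.ip x (s.repL ρ (star k) y) := by
  have hc : ∀ {f g : s.hilbert → s.hilbert}, Continuous f → Continuous g →
      Continuous fun x => s.hilbert.ip (f x) (g x) := fun hf hg =>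
    s.hilbert.continuous_ip.comp (hf.prodMk hg)
  induction x using s.hilbert_ind with
  | hp =>
    exact isClosed_eq (hc (s.repL ρ k).continuous continuous_const) (hc continuous_id continuous_const)
  | h x =>
  induction y using s.hilbert_ind with
  | hp =>
    exact isClosed_eq (hc continuous_const continuous_id)
      (hc continuous_const (s.repL ρ (star k)).continuous)
  | h y =>
  rw [s.repL_apply ρ hρ, s.repL_apply ρ hρ, s.ip_toHilbert, s.ip_toHilbert, hρ]

/-- The extension to the completion of an operator of a `*`-representation, as an adjointable
operator. -/
def repAdj (k : K) : Adj s.hilbert := ⟨s.repL ρ k, s.repL ρ (star k), s.repL_adj ρ hρ k⟩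

lemma repAdj_apply (k : K) (x : V) :
    (s.repAdj ρ hρ k).1 (s.toHilbert x) = s.toHilbert (ρ k x) := s.repL_apply ρ hρ k x

lemma adj_ext {S T : Adj s.hilbert} (h : ∀ x, S.1 (s.toHilbert x) = T.1 (s.toHilbert x)) :
    S = T :=
  Subtype.ext (s.clm_ext h)

/-- A `*`-representation of a unital C⋆-algebra on a semi-inner product module is automatically
bounded, so that it extends to a `*`-homomorphism into the adjointable operators on the
completion. -/
def liftRep : K →⋆ₐ[ℂ] Adj s.hilbert where
  toFun := s.repAdj ρ hρ
  map_one' := s.adj_ext fun x => by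
    rw [repAdj_apply, map_one]; rfl
  map_mul' k l := s.adj_ext fun x => by
    change _ = (s.repAdj ρ hρ k).1 ((s.repAdj ρ hρ l).1 (s.toHilbert x))
    rw [repAdj_apply, repAdj_apply, repAdj_apply, map_mul]; rfl
  map_zero' := s.adj_ext fun x => by
    rw [repAdj_apply, map_zero, LinearMap.zero_apply, map_zero]; rfl
  map_add' k l := s.adj_ext fun x => by
    change _ = (s.repAdj ρ hρ k).1 (s.toHilbert x) + (s.repAdj ρ hρ l).1 (s.toHilbert x)
    rw [repAdj_apply, repAdj_apply, repAdj_apply, map_add, LinearMap.add_apply, map_add]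
  commutes' c := s.adj_ext fun x => by
    change _ = c • (s.toHilbert x)
    rw [repAdj_apply, AlgHom.commutes, Module.algebraMap_end_apply, map_smul]
  map_star' k :=
    (Adj.star_eq_of (S := s.repAdj ρ hρ (star k)) (T := s.repAdj ρ hρ k)
      fun x y => s.repL_adj ρ hρ k x y).symm

lemma liftRep_apply (k : K) (x : V) :
    (s.liftRep ρ hρ k).1 (s.toHilbert x) = s.toHilbert (ρ k x) := s.repAdj_apply ρ hρ k x

end liftRep
end SemiInner

variable (B) in
/-- A Hilbert `B`-`B`-bimodule: a right Hilbert `B`-module together with a left action of `B` by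
adjointable operators. -/
structure HilbertBimodule where
  mod : HilbertModule.{u, v} B
  left : B →⋆ₐ[ℂ] Adj mod

instance : CoeSort (HilbertBimodule.{u, v} B) (Type v) := ⟨fun N => N.mod⟩

/-- The left action of `B` on a Hilbert bimodule. -/
abbrev HilbertBimodule.act (N : HilbertBimodule.{u, v} B) (b : B) : N →L[ℂ] N := (N.left b).1

lemma Adj.apply_rsmul {X : HilbertModule.{u, v} B} (T : Adj X) (b : Bᵐᵒᵖ) (x : X) :
    T.1 (b • x) = b • T.1 x := by
  obtain ⟨b, rfl⟩ := op_surjective b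
  refine X.ext_ip fun z => ?_
  rw [← Adj.ip_star_left]
  refine (X.inner.rsmul_right _ _ _).trans (Eq.trans ?_ (X.inner.rsmul_right _ _ _).symm)
  exact congrArg (· * b) (Adj.ip_star_left T z x)

namespace HilbertBimodule

variable (N : HilbertBimodule.{u, v} B)

lemma act_add (b c : B) (n : N) : N.act (b + c) n = N.act b n + N.act c n := by
  rw [act, map_add]; rfl

lemma act_smul (z : ℂ) (b : B) (n : N) : N.act (z • b) n = z • N.act b n := by
  rw [act, map_smul]; rfl

lemma act_mul (b c : B) (n : N) : N.act (b * c) n = N.act b (N.act c n) := by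
  rw [act, map_mul]; rfl

lemma act_one (n : N) : N.act 1 n = n := by
  rw [act, map_one]; rfl

lemma act_zero (n : N) : N.act 0 n = 0 := by
  rw [act, map_zero]; rfl

lemma act_algebraMap (z : ℂ) (n : N) : N.act (algebraMap ℂ B z) n = z • n := by
  rw [act, AlgHomClass.commutes]; rfl

lemma act_sum {ι : Type*} (t : Finset ι) (b : ι → B) (n : N) :
    N.act (∑ i ∈ t, b i) n = ∑ i ∈ t, N.act (b i) n :=
  map_sum (⟨⟨fun b => N.act b n, N.act_zero n⟩, fun b c => N.act_add b c n⟩ : B →+ N)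
    b t

lemma ip_act (b : B) (x y : N) : N.mod.ip (N.act b x) y = N.mod.ip x (N.act (star b) y) := by
  rw [act, act, map_star, Adj.ip_star_right]

end HilbertBimodule

section Tensor

variable (M : HilbertModule.{u, v} B) (N : HilbertBimodule.{u, w} B)

/-- The algebraic tensor product over `ℂ`, as a right `B`-module via its second factor. -/
def AlgTensor : Type max v w := M ⊗[ℂ] N

namespace AlgTensor

instance : AddCommGroup (AlgTensor M N) := inferInstanceAs (AddCommGroup (M ⊗[ℂ] N))
instance : Module ℂ (AlgTensor M N) := inferInstanceAs (Module ℂ (M ⊗[ℂ] N))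

variable {M N} in
/-- Elementary tensors. -/
def tmul (m : M) (n : N) : AlgTensor M N := m ⊗ₜ[ℂ] n

variable {M N} in
lemma ind {p : AlgTensor M N → Prop} (t : AlgTensor M N) (h0 : p 0) (h : ∀ m n, p (tmul m n))
    (hadd : ∀ s t, p s → p t → p (s + t)) : p t :=
  TensorProduct.induction_on t h0 h hadd

/-- Right multiplication by an element of `B` on the second factor. -/
def rmul (b : Bᵐᵒᵖ) : AlgTensor M N →ₗ[ℂ] AlgTensor M N :=
  LinearMap.lTensor M (DistribSMul.toLinearMap ℂ N b)

lemma hom_ext {P : Type*} [AddCommGroup P] [Module ℂ P] {f g : AlgTensor M N →ₗ[ℂ] P}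
    (h : ∀ m n, f (tmul m n) = g (tmul m n)) : f = g :=
  TensorProduct.ext' h

lemma rmul_tmul (b : Bᵐᵒᵖ) (m : M) (n : N) : rmul M N b (tmul m n) = tmul m (b • n) := rfl

instance : Module Bᵐᵒᵖ (AlgTensor M N) where
  smul b t := rmul M N b t
  one_smul t := by
    have : rmul M N 1 = LinearMap.id := hom_ext M N fun m n => by
      rw [rmul_tmul, one_smul]; rfl
    exact congrArg (fun f => f t) this
  mul_smul b c t := by
    have : rmul M N (b * c) = rmul M N b ∘ₗ rmul M N c := hom_ext M N fun m n => by
      rw [rmul_tmul, mul_smul]; rfl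
    exact congrArg (fun f => f t) this
  smul_zero b := map_zero (rmul M N b)
  smul_add b := map_add (rmul M N b)
  add_smul b c t := by
    have : rmul M N (b + c) = rmul M N b + rmul M N c := hom_ext M N fun m n => by
      rw [rmul_tmul, add_smul]; exact TensorProduct.tmul_add _ _ _
    exact congrArg (fun f => f t) this
  zero_smul t := by
    have : rmul M N 0 = 0 := hom_ext M N fun m n => by
      rw [rmul_tmul, zero_smul]; exact TensorProduct.tmul_zero _ _
    exact congrArg (fun f => f t) this

lemma rsmul_tmul (b : Bᵐᵒᵖ) (m : M) (n : N) : b • (tmul m n) = tmul m (b • n) := rfl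

/-- The functional `⟨m ⊗ n, ·⟩`. -/
def formAux (m : M) (n : N) : AlgTensor M N →ₗ[ℂ] B :=
  TensorProduct.lift <| LinearMap.mk₂ ℂ (fun m' n' => N.mod.ip n (N.act (M.ip m m') n'))
    (fun m₁ m₂ n' => by
      rw [show M.ip m (m₁ + m₂) = M.ip m m₁ + M.ip m m₂ from M.inner.add_right _ _ _, N.act_add]
      exact N.mod.inner.add_right _ _ _)
    (fun c m' n' => by
      rw [show M.ip m (c • m') = c • M.ip m m' from M.inner.smul_right _ _ _, N.act_smul]
      exact N.mod.inner.smul_right _ _ _)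
    (fun m' n₁ n₂ => by rw [map_add]; exact N.mod.inner.add_right _ _ _)
    (fun c m' n' => by rw [map_smul]; exact N.mod.inner.smul_right _ _ _)

lemma formAux_tmul (m m' : M) (n n' : N) :
    formAux M N m n (tmul m' n') = N.mod.ip n (N.act (M.ip m m') n') := rfl

/-- The form `⟨m ⊗ n, m' ⊗ n'⟩ = ⟨n, ⟨m, m'⟩ n'⟩`, as a sesquilinear map. -/
def sesqAux : AlgTensor M N →ₗ⋆[ℂ] AlgTensor M N →ₗ[ℂ] B :=
  TensorProduct.lift <| LinearMap.mk₂'ₛₗ (starRingEnd ℂ) (starRingEnd ℂ) (formAux M N)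
    (fun m₁ m₂ n => hom_ext M N fun m' n' => by
      rw [LinearMap.add_apply, formAux_tmul, formAux_tmul, formAux_tmul,
        show M.ip (m₁ + m₂) m' = M.ip m₁ m' + M.ip m₂ m' from M.inner.add_left _ _ _, N.act_add]
      exact N.mod.inner.add_right _ _ _)
    (fun c m n => hom_ext M N fun m' n' => by
      rw [LinearMap.smul_apply, formAux_tmul, formAux_tmul,
        show M.ip (c • m) m' = star c • M.ip m m' from M.inner.smul_left _ _ _, N.act_smul]
      exact N.mod.inner.smul_right _ _ _)
    (fun m n₁ n₂ => hom_ext M N fun m' n' => by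
      exact N.mod.inner.add_left _ _ _)
    (fun c m n => hom_ext M N fun m' n' => by
      exact N.mod.inner.smul_left _ _ _)

lemma sesqAux_tmul (m m' : M) (n n' : N) :
    sesqAux M N (tmul m n) (tmul m' n') = N.mod.ip n (N.act (M.ip m m') n') := rfl

lemma sesqAux_star (s t : AlgTensor M N) : star (sesqAux M N s t) = sesqAux M N t s := by
  induction s using AlgTensor.ind with
  | h0 => simp
  | hadd s s' hs hs' => simp only [map_add, LinearMap.add_apply, star_add, hs, hs']
  | h m n =>
    induction t using AlgTensor.ind with
    | h0 => simp
    | hadd t t' ht ht' => simp only [map_add, LinearMap.add_apply, star_add, ht, ht']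
    | h m' n' =>
      rw [sesqAux_tmul, sesqAux_tmul]
      refine (N.mod.inner.star_form _ _).trans ((N.ip_act _ _ _).trans ?_)
      exact congrArg (fun b => N.mod.ip n' (N.act b n)) (M.inner.star_form _ _)

lemma exists_sum (t : AlgTensor M N) :
    ∃ (k : ℕ) (m : Fin k → M) (n : Fin k → N), t = ∑ i, tmul (m i) (n i) := by
  induction t using AlgTensor.ind with
  | h0 => exact ⟨0, Fin.elim0, Fin.elim0, by simp⟩
  | h m n => exact ⟨1, fun _ => m, fun _ => n, by simp⟩
  | hadd s t hs ht =>
    obtain ⟨k, m, n, rfl⟩ := hs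
    obtain ⟨l, m', n', rfl⟩ := ht
    exact ⟨k + l, Fin.append m m', Fin.append n n', by simp [Fin.sum_univ_add]⟩

lemma sesqAux_nonneg (t : AlgTensor M N) : 0 ≤ sesqAux M N t t := by
  obtain ⟨k, m, n, rfl⟩ := exists_sum M N t
  obtain ⟨Y, hY⟩ := M.inner.exists_gram m
  have h1 : ∀ i j, N.mod.ip (n i) (N.act (M.ip (m i) (m j)) (n j))
      = ∑ l, N.mod.ip (N.act (Y l i) (n i)) (N.act (Y l j) (n j)) := by
    intro i j
    rw [show M.ip (m i) (m j) = _ from hY i j, N.act_sum]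
    refine (N.mod.inner.sum_right _ _ _).trans (Finset.sum_congr rfl fun l _ => ?_)
    rw [N.act_mul]
    exact (N.ip_act _ _ _).symm
  have h : sesqAux M N (∑ i, tmul (m i) (n i)) (∑ i, tmul (m i) (n i))
      = ∑ l, N.mod.ip (∑ i, N.act (Y l i) (n i)) (∑ j, N.act (Y l j) (n j)) := by
    have h2 : ∀ l, N.mod.ip (∑ i, N.act (Y l i) (n i)) (∑ j, N.act (Y l j) (n j))
        = ∑ j, ∑ i, N.mod.ip (N.act (Y l i) (n i)) (N.act (Y l j) (n j)) := fun l =>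
      (N.mod.inner.sum_right _ _ _).trans
        (Finset.sum_congr rfl fun j _ => N.mod.inner.sum_left _ _ _)
    simp only [map_sum, LinearMap.sum_apply, sesqAux_tmul, h1, h2]
    conv_rhs => rw [Finset.sum_comm]
    conv_rhs => enter [2, j]; rw [Finset.sum_comm]
  rw [h]
  exact Finset.sum_nonneg fun l _ => N.mod.inner.self_nonneg _

lemma sesqAux_rsmul (b : B) (s t : AlgTensor M N) :
    sesqAux M N s (op b • t) = sesqAux M N s t * b := by
  induction s using AlgTensor.ind with
  | h0 => simp
  | hadd s s' hs hs' => simp only [map_add, LinearMap.add_apply, hs, hs', add_mul]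
  | h m n =>
    induction t using AlgTensor.ind with
    | h0 => simp
    | hadd t t' ht ht' => simp only [smul_add, map_add, ht, ht', add_mul]
    | h m' n' =>
      rw [rsmul_tmul, sesqAux_tmul, sesqAux_tmul, Adj.apply_rsmul]
      exact N.mod.inner.rsmul_right _ _ _

/-- The semi-inner product `⟨m ⊗ n, m' ⊗ n'⟩ = ⟨n, ⟨m, m'⟩ n'⟩`. -/
def semiInner : SemiInner B (AlgTensor M N) where
  form s t := sesqAux M N s t
  add_right s t t' := map_add _ _ _
  smul_right c s t := map_smul _ _ _
  rsmul_right b s t := sesqAux_rsmul M N b s t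
  star_form := sesqAux_star M N
  self_nonneg := sesqAux_nonneg M N

/-- The `*`-representation `T ↦ T ⊗ 1` on the algebraic tensor product. -/
def opTensor : Adj M →ₐ[ℂ] Module.End ℂ (AlgTensor M N) where
  toFun T := LinearMap.rTensor N (T.1 : M →ₗ[ℂ] M)
  map_one' := hom_ext M N fun m n => rfl
  map_mul' S T := hom_ext M N fun m n => rfl
  map_zero' := hom_ext M N fun m n => TensorProduct.zero_tmul _ _
  map_add' S T := hom_ext M N fun m n => TensorProduct.add_tmul _ _ _
  commutes' c := hom_ext M N fun m n => rfl

lemma opTensor_tmul (T : Adj M) (m : M) (n : N) :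
    opTensor M N T (tmul m n) = tmul (T.1 m) n := rfl

lemma opTensor_adj (T : Adj M) (s t : AlgTensor M N) :
    sesqAux M N (opTensor M N T s) t = sesqAux M N s (opTensor M N (star T) t) := by
  induction s using AlgTensor.ind with
  | h0 => simp
  | hadd s s' hs hs' => simp only [map_add, LinearMap.add_apply, hs, hs']
  | h m n =>
    induction t using AlgTensor.ind with
    | h0 => simp
    | hadd t t' ht ht' => simp only [map_add, ht, ht']
    | h m' n' =>
      rw [opTensor_tmul, opTensor_tmul, sesqAux_tmul, sesqAux_tmul, Adj.ip_star_right]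

end AlgTensor

/-- The interior tensor product `M ⊗_B N` as a right Hilbert module. -/
def tensorModule : HilbertModule.{u, max v w} B := (AlgTensor.semiInner M N).hilbert

variable {M N} in
/-- Elementary tensors in the interior tensor product. -/
def tmul (m : M) (n : N) : tensorModule M N :=
  (AlgTensor.semiInner M N).toHilbert (AlgTensor.tmul m n)

/-- The `*`-homomorphism `T ↦ T ⊗ 1` from `𝓛(M)` to `𝓛(M ⊗_B N)`. -/
def tensorOne : Adj M →⋆ₐ[ℂ] Adj (tensorModule M N) :=
  (AlgTensor.semiInner M N).liftRep (AlgTensor.opTensor M N) (AlgTensor.opTensor_adj M N)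

/-- Elementary tensors, as a bilinear map. -/
def tmulₗ : M →ₗ[ℂ] N →ₗ[ℂ] tensorModule M N :=
  LinearMap.mk₂ ℂ tmul
    (fun m m' n => (congrArg _ (TensorProduct.add_tmul m m' n)).trans (map_add _ _ _))
    (fun c m n => (congrArg _ (TensorProduct.smul_tmul' c m n).symm).trans (map_smul _ _ _))
    (fun m n n' => (congrArg _ (TensorProduct.tmul_add m n n')).trans (map_add _ _ _))
    (fun c m n => (congrArg _ (TensorProduct.tmul_smul c m n)).trans (map_smul _ _ _))

lemma tmulₗ_apply (m : M) (n : N) : tmulₗ M N m n = tmul m n := rfl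

lemma tmul_rsmul (b : Bᵐᵒᵖ) (m : M) (n : N) : tmul m (b • n) = b • tmul m n :=
  (AlgTensor.semiInner M N).toHilbert_rsmul b (AlgTensor.tmul m n)

lemma tensorOne_tmul (T : Adj M) (m : M) (n : N) :
    (tensorOne M N T).1 (tmul m n) = tmul (T.1 m) n :=
  (AlgTensor.semiInner M N).liftRep_apply _ _ T _

lemma ip_tmul (m m' : M) (n n' : N) :
    (tensorModule M N).ip (tmul m n) (tmul m' n') = N.mod.ip n (N.act (M.ip m m') n') :=
  (AlgTensor.semiInner M N).ip_toHilbert _ _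

/-- The interior tensor product is balanced over `B`. -/
lemma tmul_act (m : M) (b : B) (n : N) : tmul (op b • m) n = tmul m (N.act b n) := by
  have e : ∀ m' n' m'' n'', (tensorModule M N).inner.form (tmul m' n') (tmul m'' n'')
    = N.mod.ip n' (N.act (M.ip m' m'') n'') := fun m' n' m'' n'' => ip_tmul M N m' m'' n' n''
  have e1 : ∀ x, M.ip x (op b • m) = M.ip x m * b := fun x => M.inner.rsmul_right b x m
  have e2 : ∀ x, M.ip (op b • m) x = star b * M.ip m x := fun x => M.inner.rsmul_left b m x
  have h : (tensorModule M N).inner.form (tmul (op b • m) n - tmul m (N.act b n))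
      (tmul (op b • m) n - tmul m (N.act b n)) = 0 := by
    rw [(tensorModule M N).inner.sub_right, (tensorModule M N).inner.sub_left,
      (tensorModule M N).inner.sub_left, e, e, e, e, e1, e1, e2, N.ip_act, N.ip_act,
      N.act_mul, N.act_mul, N.act_mul, sub_self]
  have h1 := (tensorModule M N).norm_sq (tmul (op b • m) n - tmul m (N.act b n))
  rw [h, norm_zero, sq_eq_zero_iff, norm_eq_zero] at h1
  exact sub_eq_zero.1 h1

end Tensor
end Constructions

open scoped Classical

section Sums

variable {B : Type u} [CStarAlgebra B] [PartialOrder B] [StarOrderedRing B]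

variable (B) in
/-- `B` as a right Hilbert `B`-module, with `⟨x, y⟩ = x* y`. -/
def trivialModule : HilbertModule.{u, u} B where
  carrier := B
  inner :=
    { form := fun x y => star x * y
      add_right := fun x y z => mul_add _ _ _
      smul_right := fun c x y => mul_smul_comm _ _ _
      rsmul_right := fun b x y => (mul_assoc _ _ _).symm
      star_form := fun x y => by rw [star_mul, star_star]
      self_nonneg := fun x => star_mul_self_nonneg x }
  norm_sq := fun x => by rw [CStarRing.norm_star_mul_self, pow_two]

lemma trivial_adj (b x y : B) : star (b * x) * y = star x * (star b * y) := by
  rw [star_mul, mul_assoc]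

/-- Left multiplication on `B`. -/
def trivialLeft (b : B) : Adj (trivialModule B) :=
  ⟨ContinuousLinearMap.mul ℂ B b, ContinuousLinearMap.mul ℂ B (star b), trivial_adj b⟩

variable (B) in
/-- `B` as a Hilbert `B`-`B`-bimodule. -/
def trivialBimodule : HilbertBimodule.{u, u} B where
  mod := trivialModule B
  left :=
    { toFun := trivialLeft
      map_one' := Adj.ext_apply fun x => one_mul (M := B) x
      map_mul' := fun b c => Adj.ext_apply fun x => mul_assoc (G := B) b c x
      map_zero' := Adj.ext_apply fun x => zero_mul (M₀ := B) x
      map_add' := fun b c => Adj.ext_apply fun x => add_mul (R := B) b c x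
      commutes' := fun z => Adj.ext_apply fun x => (Algebra.smul_def (A := B) z x).symm
      map_star' := fun b => (Adj.star_eq_of (T := trivialLeft b) (S := trivialLeft (star b))
        (trivial_adj b)).symm }

section DirectSum

variable {J : Type w} (F : J → HilbertBimodule.{u, v} B)

/-- The algebraic direct sum. -/
abbrev AlgSum : Type max v w := Π₀ j, F j

namespace AlgSum

/-- `⟨x, y⟩ = ∑ j, ⟨x j, y j⟩`. -/
def form (x y : AlgSum F) : B := DFinsupp.lsum ℂ (fun j => (F j).mod.inner.sesq (x j)) y

/-- The inclusion of a summand. -/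
def single (j : J) : F j →ₗ[ℂ] AlgSum F := DFinsupp.lsingle (R := ℂ) (M := fun j => F j) j

lemma form_single (x : AlgSum F) (j : J) (y : F j) :
    form F x (single F j y) = (F j).mod.ip (x j) y :=
  DFinsupp.sumAddHom_single (β := fun j => F j)
    (fun j => ((F j).mod.inner.sesq (x j)).toAddMonoidHom) j y

lemma single_same (j : J) (x : F j) : single F j x j = x :=
  DFinsupp.single_eq_same (β := fun j => F j)

lemma single_ne {j k : J} (h : j ≠ k) (x : F j) : single F j x k = 0 :=
  DFinsupp.single_eq_of_ne (β := fun j => F j) h.symm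

lemma ind {p : AlgSum F → Prop} (x : AlgSum F) (h0 : p 0) (h : ∀ j y, p (single F j y))
    (hadd : ∀ x y, p x → p y → p (x + y)) : p x :=
  DFinsupp.induction x h0 fun j b f _ _ hf => hadd _ _ (h j b) hf

lemma hom_ext {P : Type*} [AddCommGroup P] [Module ℂ P] {f g : AlgSum F →ₗ[ℂ] P}
    (h : ∀ j y, f (single F j y) = g (single F j y)) : f = g :=
  DFinsupp.lhom_ext (M := fun j => F j) h

/-- The linear map on the algebraic direct sum given by linear maps on the summands. -/
def lift {P : Type*} [AddCommGroup P] [Module ℂ P] (f : ∀ j, F j →ₗ[ℂ] P) : AlgSum F →ₗ[ℂ] P :=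
  DFinsupp.lsum ℂ f

lemma lift_single {P : Type*} [AddCommGroup P] [Module ℂ P] (f : ∀ j, F j →ₗ[ℂ] P) (j : J)
    (y : F j) : lift F f (single F j y) = f j y :=
  DFinsupp.sumAddHom_single (β := fun j => F j) (fun j => (f j).toAddMonoidHom) j y

lemma form_eq_sum (x y : AlgSum F) (s : Finset J) (hs : y.support ⊆ s) :
    form F x y = ∑ j ∈ s, (F j).mod.ip (x j) (y j) := by
  change DFinsupp.sumAddHom _ y = _
  rw [DFinsupp.sumAddHom_apply]
  refine Finset.sum_subset hs fun j _ hj => ?_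
  rw [DFinsupp.notMem_support_iff] at hj
  rw [hj]
  exact map_zero _

/-- The algebraic direct sum as a semi-inner product module. -/
def semiInner : SemiInner B (AlgSum F) where
  form := form F
  add_right x y z := map_add _ _ _
  smul_right c x y := map_smul _ _ _
  rsmul_right b x y := by
    rw [form_eq_sum F x (op b • y) (y.support) (DFinsupp.support_smul _ _),
      form_eq_sum F x y _ subset_rfl, Finset.sum_mul]
    exact Finset.sum_congr rfl fun j _ => (F j).mod.inner.rsmul_right _ _ _
  star_form x y := by
    rw [form_eq_sum F x y (x.support ∪ y.support) Finset.subset_union_right,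
      form_eq_sum F y x (x.support ∪ y.support) Finset.subset_union_left, star_sum]
    exact Finset.sum_congr rfl fun j _ => (F j).mod.inner.star_form _ _
  self_nonneg x := by
    rw [form_eq_sum F x x _ subset_rfl]
    exact Finset.sum_nonneg fun j _ => (F j).mod.inner.self_nonneg _

/-- The diagonal left action of `B`. -/
def diag : B →ₐ[ℂ] Module.End ℂ (AlgSum F) where
  toFun b := DFinsupp.mapRange.linearMap fun j => ((F j).act b : F j →ₗ[ℂ] F j)
  map_one' := LinearMap.ext fun x => DFinsupp.ext fun j => (F j).act_one (x j)
  map_mul' b c := LinearMap.ext fun x => DFinsupp.ext fun j => (F j).act_mul b c (x j)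
  map_zero' := LinearMap.ext fun x => DFinsupp.ext fun j => (F j).act_zero (x j)
  map_add' b c := LinearMap.ext fun x => DFinsupp.ext fun j => (F j).act_add b c (x j)
  commutes' c := LinearMap.ext fun x => DFinsupp.ext fun j => (F j).act_algebraMap c (x j)

lemma diag_apply (b : B) (x : AlgSum F) (j : J) : diag F b x j = (F j).act b (x j) := rfl

lemma diag_adj (b : B) (x y : AlgSum F) :
    form F (diag F b x) y = form F x (diag F (star b) y) := by
  rw [form_eq_sum F _ y (y.support ∪ (diag F (star b) y).support) Finset.subset_union_left,
    form_eq_sum F x _ (y.support ∪ (diag F (star b) y).support) Finset.subset_union_right]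
  exact Finset.sum_congr rfl fun j _ => (F j).ip_act b _ _

end AlgSum

/-- The direct sum of a family of Hilbert `B`-`B`-bimodules. -/
def directSum : HilbertBimodule.{u, max v w} B where
  mod := (AlgSum.semiInner F).hilbert
  left := (AlgSum.semiInner F).liftRep (AlgSum.diag F) (AlgSum.diag_adj F)

/-- The inclusion of a summand. -/
def incl (j : J) : F j →ₗ[ℂ] directSum F :=
  (AlgSum.semiInner F).toHilbert ∘ₗ AlgSum.single F j

variable {F}

lemma ip_incl (j : J) (x y : F j) :
    (directSum F).mod.ip (incl F j x) (incl F j y) = (F j).mod.ip x y := by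
  refine ((AlgSum.semiInner F).ip_toHilbert _ _).trans ((AlgSum.form_single F _ _ _).trans ?_)
  rw [AlgSum.single_same]

lemma ip_incl_of_ne {j k : J} (h : j ≠ k) (x : F j) (y : F k) :
    (directSum F).mod.ip (incl F j x) (incl F k y) = 0 := by
  refine ((AlgSum.semiInner F).ip_toHilbert _ _).trans ((AlgSum.form_single F _ _ _).trans ?_)
  rw [AlgSum.single_ne F h]
  exact (F k).mod.inner.zero_left y

lemma act_incl (j : J) (b : B) (x : F j) :
    (directSum F).act b (incl F j x) = incl F j ((F j).act b x) := by
  refine ((AlgSum.semiInner F).liftRep_apply (AlgSum.diag F) (AlgSum.diag_adj F) b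
    (AlgSum.single F j x)).trans ?_
  refine congrArg (AlgSum.semiInner F).toHilbert (DFinsupp.ext fun k => ?_)
  rw [AlgSum.diag_apply]
  by_cases h : j = k
  · subst h; rw [AlgSum.single_same, AlgSum.single_same]
  · rw [AlgSum.single_ne F h, AlgSum.single_ne F h, map_zero]

lemma incl_rsmul (j : J) (b : Bᵐᵒᵖ) (x : F j) : incl F j (b • x) = b • incl F j x := by
  refine Eq.trans ?_ ((AlgSum.semiInner F).toHilbert_rsmul b (AlgSum.single F j x))
  refine congrArg (AlgSum.semiInner F).toHilbert (DFinsupp.ext fun k => ?_)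
  rw [DFinsupp.smul_apply]
  by_cases h : j = k
  · subst h; rw [AlgSum.single_same, AlgSum.single_same]
  · rw [AlgSum.single_ne F h, AlgSum.single_ne F h, smul_zero]

end DirectSum

section Sub

variable (X : HilbertModule.{u, v} B) (ξ : X)

/-- The orthogonal complement `{m | ⟨ξ, m⟩ = 0}` as a subspace. -/
def perp : Submodule ℂ X where
  carrier := {m | X.ip ξ m = 0}
  add_mem' := fun {x y} hx hy => by
    change X.ip ξ (x + y) = 0
    rw [HilbertModule.ip, X.inner.add_right]
    change X.ip ξ x + X.ip ξ y = 0
    rw [hx, hy, add_zero]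
  zero_mem' := X.inner.zero_right ξ
  smul_mem' c x hx := by
    change X.ip ξ (c • x) = 0
    rw [HilbertModule.ip, X.inner.smul_right]
    change c • X.ip ξ x = 0
    rw [hx, smul_zero]

lemma mem_perp {m : X} : m ∈ perp X ξ ↔ X.ip ξ m = 0 := Iff.rfl

lemma rsmul_mem_perp (b : Bᵐᵒᵖ) {m : X} (hm : m ∈ perp X ξ) : b • m ∈ perp X ξ := by
  obtain ⟨b, rfl⟩ := op_surjective b
  rw [mem_perp] at hm ⊢
  rw [HilbertModule.ip, X.inner.rsmul_right]
  change X.ip ξ m * b = 0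
  rw [hm, zero_mul]

lemma isClosed_perp : IsClosed (perp X ξ : Set X) :=
  isClosed_eq (X.continuous_ip.comp (continuous_const.prodMk continuous_id)) continuous_const

instance : SMul Bᵐᵒᵖ (perp X ξ) := ⟨fun b m => ⟨b • m.1, rsmul_mem_perp X ξ b m.2⟩⟩

instance : Module Bᵐᵒᵖ (perp X ξ) :=
  Function.Injective.module Bᵐᵒᵖ (perp X ξ).subtype.toAddMonoidHom Subtype.val_injective
    fun _ _ => rfl

/-- The Hilbert submodule `{m | ⟨ξ, m⟩ = 0}`. -/
def perpModule : HilbertModule.{u, v} B where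
  carrier := perp X ξ
  completeSpace := (isClosed_perp X ξ).completeSpace_coe
  inner :=
    { form := fun x y => X.ip x.1 y.1
      add_right := fun x y z => X.inner.add_right _ _ _
      smul_right := fun c x y => X.inner.smul_right _ _ _
      rsmul_right := fun b x y => X.inner.rsmul_right _ _ _
      star_form := fun x y => X.inner.star_form _ _
      self_nonneg := fun x => X.inner.self_nonneg _ }
  norm_sq := fun x => X.norm_sq x.1

/-- The restriction to `{m | ⟨ξ, m⟩ = 0}` of a left action which maps this submodule into itself. -/
def perpBimodule (L : B →⋆ₐ[ℂ] Adj X)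
    (hL : ∀ b m, X.ip ξ m = 0 → X.ip ξ ((L b).1 m) = 0) : HilbertBimodule.{u, v} B where
  mod := perpModule X ξ
  left :=
    let R : B → (perp X ξ →L[ℂ] perp X ξ) := fun b =>
      (((L b).1).comp (perp X ξ).subtypeL).codRestrict (perp X ξ) fun m => hL b m.1 m.2
    have hR : ∀ b (x y : perp X ξ), X.ip (R b x).1 y.1 = X.ip x.1 (R (star b) y).1 := fun b x y => by
      change X.ip ((L b).1 x.1) y.1 = X.ip x.1 ((L (star b)).1 y.1)
      rw [map_star, Adj.ip_star_right]
    { toFun := fun b => ⟨R b, R (star b), hR b⟩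
      map_one' := Adj.ext_apply fun x => Subtype.ext <| by
        change (L 1).1 x.1 = x.1
        rw [map_one]; rfl
      map_mul' := fun b c => Adj.ext_apply fun x => Subtype.ext <| by
        change (L (b * c)).1 x.1 = (L b).1 ((L c).1 x.1)
        rw [map_mul]; rfl
      map_zero' := Adj.ext_apply fun x => Subtype.ext <| by
        change (L 0).1 x.1 = 0
        rw [map_zero]; rfl
      map_add' := fun b c => Adj.ext_apply fun x => Subtype.ext <| by
        change (L (b + c)).1 x.1 = (L b).1 x.1 + (L c).1 x.1
        rw [map_add]; rfl
      commutes' := fun z => Adj.ext_apply fun x => Subtype.ext <| by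
        change (L (algebraMap ℂ B z)).1 x.1 = z • x.1
        rw [AlgHomClass.commutes]; rfl
      map_star' := fun b => (Adj.star_eq_of fun x y => hR b x y).symm }

end Sub

/-- The interior tensor product `M ⊗_B N` of Hilbert `B`-`B`-bimodules. -/
def tensorBimodule (M : HilbertBimodule.{u, v} B) (N : HilbertBimodule.{u, w} B) :
    HilbertBimodule.{u, max v w} B where
  mod := tensorModule M.mod N
  left := (tensorOne M.mod N).comp M.left

end Sums

section KSGNS

variable (B : Type u) [CStarAlgebra B] [PartialOrder B] [StarOrderedRing B]

/-- A unital C⋆-algebra `A` containing a copy of `B` as a unital C⋆-subalgebra, together with a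
conditional expectation of `A` onto `B`: a positive `B`-bimodule map which is the identity on `B`.
(The embedding of `B` is injective because of `map_embed`.) -/
structure CondExp (A : Type v) [CStarAlgebra A] where
  embed : B →⋆ₐ[ℂ] A
  map : A →ₗ[ℂ] B
  map_embed : ∀ b, map (embed b) = b
  map_bimod : ∀ b a c, map (embed b * a * embed c) = b * map a * c
  map_nonneg : ∀ a, 0 ≤ map (star a * a)

/-- Faithfulness of a (positive) linear map: `E (a* a) = 0` implies `a = 0`. -/
def IsFaithful {A : Type v} {C : Type w} [Ring A] [StarRing A] [Module ℂ A] [AddCommGroup C]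
    [Module ℂ C] (E : A →ₗ[ℂ] C) : Prop :=
  ∀ a, E (star a * a) = 0 → a = 0

variable {B} {A : Type v} [CStarAlgebra A] (E : CondExp B A)

namespace CondExp

lemma map_mul_embed (a : A) (b : B) : E.map (a * E.embed b) = E.map a * b := by
  simpa using E.map_bimod 1 a b

lemma map_embed_mul (b : B) (a : A) : E.map (E.embed b * a) = b * E.map a := by
  simpa using E.map_bimod b a 1

lemma star_map (a : A) : star (E.map a) = E.map (star a) := by
  have key : ∀ c : ℂ, star c • star (E.map a) + c • star (E.map (star a))
      = c • E.map a + star c • E.map (star a) := by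
    intro c
    have h : ∀ x : A, star (E.map (star x * x)) = E.map (star x * x) := fun x =>
      (IsSelfAdjoint.of_nonneg (E.map_nonneg x)).star_eq
    have e : star (1 + c • a) * (1 + c • a)
        = star (1 : A) * 1 + (c • a + star c • star a) + star (c • a) * (c • a) := by
      rw [star_add, add_mul, mul_add, mul_add, star_one, one_mul, one_mul, mul_one, star_smul]
      abel
    have h1 := h (1 + c • a)
    rw [e, map_add, map_add, star_add, star_add, h, h, map_add, map_smul, map_smul, star_add,
      star_smul, star_smul, star_star] at h1
    exact add_left_cancel (add_right_cancel h1)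
  have h1 := key 1
  have h2 := key Complex.I
  simp only [star_one, one_smul, Complex.star_def, Complex.conj_I, neg_smul] at h1 h2
  have h3 : star (E.map (star a)) - star (E.map a) = E.map a - E.map (star a) := by
    have h4 := congrArg (fun x => (-Complex.I) • x) h2
    simpa [smul_add, smul_smul, sub_eq_add_neg, add_comm] using h4
  have h5 : (2 : ℂ) • star (E.map a) = (2 : ℂ) • E.map (star a) := by
    rw [two_smul, two_smul]
    have h6 := congrArg₂ (· - ·) h1 h3
    calc star (E.map a) + star (E.map a) = _ := by abel
      _ = _ := h6
      _ = _ := by abel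
  exact smul_right_injective B (two_ne_zero' ℂ) h5

/-- `A` as a right `B`-module. -/
@[nolint unusedArguments]
def Pre (_ : CondExp B A) : Type v := A

instance : AddCommGroup E.Pre := inferInstanceAs (AddCommGroup A)
instance : Module ℂ E.Pre := inferInstanceAs (Module ℂ A)
instance : Module Bᵐᵒᵖ E.Pre := Module.compHom A E.embed.toRingHom.op

/-- The form `⟨a₁, a₂⟩ = E (a₁* a₂)`. -/
def form (x y : A) : B := E.map (star x * y)

lemma form_add (x y z : A) : E.form x (y + z) = E.form x y + E.form x z := by
  rw [form, mul_add, map_add]; rfl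

lemma form_smul (c : ℂ) (x y : A) : E.form x (c • y) = c • E.form x y := by
  rw [form, mul_smul_comm, map_smul]; rfl

lemma form_mul_embed (b : B) (x y : A) : E.form x (y * E.embed b) = E.form x y * b := by
  rw [form, ← mul_assoc, map_mul_embed]; rfl

lemma star_form (x y : A) : star (E.form x y) = E.form y x := by
  rw [form, star_map, star_mul, star_star]; rfl

lemma form_mul_left (k x y : A) : E.form (k * x) y = E.form x (star k * y) := by
  rw [form, form, star_mul, mul_assoc]

/-- `A` with `⟨a₁, a₂⟩ = E (a₁* a₂)` as a semi-inner product module. -/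
def semiInner : SemiInner B E.Pre where
  form := E.form
  add_right := E.form_add
  smul_right := E.form_smul
  rsmul_right := E.form_mul_embed
  star_form := E.star_form
  self_nonneg := E.map_nonneg

/-- The right Hilbert `B`-module `L²(A, E)`. -/
def ksgns : HilbertModule.{u, v} B := E.semiInner.hilbert

/-- The element `â` of `L²(A, E)`. -/
def hat : A →ₗ[ℂ] E.ksgns := E.semiInner.toHilbert

/-- The representation of `A` on `L²(A, E)` with `π(a) b̂ = (ab)̂`. -/
def ksgnsRep : A →⋆ₐ[ℂ] Adj E.ksgns :=
  E.semiInner.liftRep (Algebra.lmul ℂ A) E.form_mul_left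

/-- The vector `ξ = 1̂`. -/
def ksgnsVec : E.ksgns := E.hat 1

lemma ip_hat (x y : A) : E.ksgns.ip (E.hat x) (E.hat y) = E.map (star x * y) :=
  E.semiInner.ip_toHilbert x y

lemma ksgnsRep_hat (a x : A) : (E.ksgnsRep a).1 (E.hat x) = E.hat (a * x) :=
  E.semiInner.liftRep_apply (Algebra.lmul ℂ A) E.form_mul_left a x

lemma hat_rsmul (b : B) (x : A) : op b • E.hat x = E.hat (x * E.embed b) :=
  (E.semiInner.toHilbert_rsmul (op b) x).symm

lemma ip_vec_vec : E.ksgns.ip E.ksgnsVec E.ksgnsVec = 1 := by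
  rw [ksgnsVec, ip_hat, star_one, one_mul, ← map_one E.embed, E.map_embed]

lemma rep_embed_vec (b : B) : (E.ksgnsRep (E.embed b)).1 E.ksgnsVec = op b • E.ksgnsVec := by
  rw [ksgnsVec, ksgnsRep_hat, hat_rsmul, mul_one, one_mul]

/-- The Hilbert bimodule `M° = P° L²(A, E)`, where `P°` is the projection onto the orthogonal
complement of `ξ`. -/
def ksgnsCirc : HilbertBimodule.{u, v} B :=
  perpBimodule E.ksgns E.ksgnsVec (E.ksgnsRep.comp E.embed) fun b m hm => by
    change E.ksgns.ip E.ksgnsVec ((E.ksgnsRep (E.embed b)).1 m) = 0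
    rw [← star_star b, map_star, map_star, Adj.ip_star_right, rep_embed_vec]
    refine (E.ksgns.inner.rsmul_left _ _ _).trans ?_
    exact (congrArg _ hm).trans (mul_zero _)

/-- The projection `P°`, `m ↦ m - ξ ⟨ξ, m⟩`, onto `M°`. -/
def projCirc : E.ksgns →ₗ[ℂ] E.ksgnsCirc where
  toFun m := (⟨m - op (E.ksgns.ip E.ksgnsVec m) • E.ksgnsVec, by
    have h1 := E.ip_vec_vec
    rw [mem_perp]
    rw [HilbertModule.ip] at h1 ⊢
    rw [E.ksgns.inner.sub_right, E.ksgns.inner.rsmul_right, h1, one_mul, sub_self]⟩ : perp E.ksgns E.ksgnsVec)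
  map_add' x y := Subtype.ext <| by
    change x + y - op (E.ksgns.ip E.ksgnsVec (x + y)) • E.ksgnsVec
      = (x - op (E.ksgns.ip E.ksgnsVec x) • E.ksgnsVec)
        + (y - op (E.ksgns.ip E.ksgnsVec y) • E.ksgnsVec)
    rw [show E.ksgns.ip E.ksgnsVec (x + y) = _ from E.ksgns.inner.add_right _ _ _, op_add, add_smul]
    abel
  map_smul' c x := Subtype.ext <| by
    change c • x - op (E.ksgns.ip E.ksgnsVec (c • x)) • E.ksgnsVec
      = c • (x - op (E.ksgns.ip E.ksgnsVec x) • E.ksgnsVec)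
    refine E.ksgns.ext_ip fun z => ?_
    simp only [HilbertModule.ip, E.ksgns.inner.sub_right, E.ksgns.inner.smul_right,
      E.ksgns.inner.rsmul_right, smul_sub, mul_smul_comm]

/-- The inclusion `M° → L²(A, E)`. -/
def circIncl : E.ksgnsCirc →ₗ[ℂ] E.ksgns := (perp E.ksgns E.ksgnsVec).subtype

lemma ip_vec_circ (z : E.ksgnsCirc) : E.ksgns.ip E.ksgnsVec (E.circIncl z) = 0 := z.2

lemma projCirc_vec : E.projCirc E.ksgnsVec = 0 := Subtype.ext <| by
  change E.ksgnsVec - op (E.ksgns.ip E.ksgnsVec E.ksgnsVec) • E.ksgnsVec = 0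
  rw [ip_vec_vec, op_one, one_smul, sub_self]

lemma projCirc_circ (z : E.ksgnsCirc) : E.projCirc (E.circIncl z) = z := Subtype.ext <| by
  change E.circIncl z - op (E.ksgns.ip E.ksgnsVec (E.circIncl z)) • E.ksgnsVec = E.circIncl z
  rw [ip_vec_circ, op_zero, zero_smul, sub_zero]

/-- `⟨m, m'⟩ = ⟨ξ, m⟩* ⟨ξ, m'⟩ + ⟨P° m, P° m'⟩`. -/
lemma ip_decomp (m m' : E.ksgns) : E.ksgns.ip m m'
    = star (E.ksgns.ip E.ksgnsVec m) * E.ksgns.ip E.ksgnsVec m'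
      + E.ksgnsCirc.mod.ip (E.projCirc m) (E.projCirc m') := by
  change _ = _ + E.ksgns.ip (m - op (E.ksgns.ip E.ksgnsVec m) • E.ksgnsVec)
    (m' - op (E.ksgns.ip E.ksgnsVec m') • E.ksgnsVec)
  have h := E.ksgns.inner.star_form E.ksgnsVec m
  have h1 := E.ip_vec_vec
  simp only [HilbertModule.ip] at h h1 ⊢
  simp only [E.ksgns.inner.sub_right, E.ksgns.inner.sub_left,
    E.ksgns.inner.rsmul_right, E.ksgns.inner.rsmul_left, ← h, h1, mul_one]
  abel

end CondExp
end KSGNS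

section Unitary

variable {B : Type u} [CStarAlgebra B] [PartialOrder B] [StarOrderedRing B]

section Conj

variable {X : HilbertModule.{u, v} B} {Y : HilbertModule.{u, w} B} (U : X ≃L[ℂ] Y)
  (hU : ∀ x y, Y.ip (U x) (U y) = X.ip x y)

/-- The operator `U S U⁻¹`. -/
def conjL (S : X →L[ℂ] X) : Y →L[ℂ] Y :=
  ((U : X →L[ℂ] Y).comp S).comp (U.symm : Y →L[ℂ] X)

lemma conjL_apply (S : X →L[ℂ] X) (y : Y) : conjL U S y = U (S (U.symm y)) := rfl

lemma conjL_adj (hU : ∀ x y, Y.ip (U x) (U y) = X.ip x y)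
    (T : Adj X) (x y : Y) :
    Y.ip (conjL U T.1 x) y = Y.ip x (conjL U (star T).1 y) := by
  rw [conjL_apply, conjL_apply]
  obtain ⟨x, rfl⟩ := U.surjective x
  obtain ⟨y, rfl⟩ := U.surjective y
  rw [U.symm_apply_apply, U.symm_apply_apply, hU, hU, Adj.ip_star_right]

/-- Conjugation `T ↦ U T U*` by a unitary operator, as a map. -/
def conjAdj (T : Adj X) : Adj Y := ⟨conjL U T.1, conjL U (star T).1, conjL_adj U hU T⟩

lemma conjAdj_apply (T : Adj X) (y : Y) : (conjAdj U hU T).1 y = U (T.1 (U.symm y)) := rfl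

/-- Conjugation `T ↦ U T U*` by a unitary operator `U : X → Y` of Hilbert modules. -/
def conjUnitary : Adj X →⋆ₐ[ℂ] Adj Y where
  toFun := conjAdj U hU
  map_one' := Adj.ext_apply fun x => U.apply_symm_apply x
  map_mul' := fun S T => Adj.ext_apply fun x => by
    change U (S.1 (T.1 (U.symm x))) = U (S.1 (U.symm (U (T.1 (U.symm x)))))
    rw [U.symm_apply_apply]
  map_zero' := Adj.ext_apply fun x => map_zero U
  map_add' := fun S T => Adj.ext_apply fun x => map_add U _ _
  commutes' := fun c => Adj.ext_apply fun x => by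
    change U (c • U.symm x) = c • x
    rw [map_smul, U.apply_symm_apply]
  map_star' := fun T => (Adj.star_eq_of (T := conjAdj U hU T) (S := conjAdj U hU (star T))
    (conjL_adj U hU T)).symm

lemma conjUnitary_apply (T : Adj X) (x : X) : (conjUnitary U hU T).1 (U x) = U (T.1 x) := by
  change U (T.1 (U.symm (U x))) = _
  rw [U.symm_apply_apply]

end Conj

lemma HilbertModule.norm_eq_of_ip {X : HilbertModule.{u, v} B} {Y : HilbertModule.{u, w} B}
    {x : X} {y : Y} (h : X.ip x x = Y.ip y y) : ‖x‖ = ‖y‖ := by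
  have h1 := X.norm_sq x
  have h2 := Y.norm_sq y
  rw [show X.inner.form x x = Y.inner.form y y from h, ← h2] at h1
  exact (sq_eq_sq₀ (norm_nonneg _) (norm_nonneg _)).1 h1

lemma HilbertModule.ip_continuous (X : HilbertModule.{u, v} B) {α : Type*} [TopologicalSpace α]
    {f g : α → X} (hf : Continuous f) (hg : Continuous g) :
    Continuous fun a => X.ip (f a) (g a) :=
  X.continuous_ip.comp (hf.prodMk hg)

end Unitary

section FreeProduct

variable {B : Type u} [CStarAlgebra B] [PartialOrder B] [StarOrderedRing B]
  {I : Type w} {A : I → Type u} [∀ i, CStarAlgebra (A i)] (E : ∀ i, CondExp B (A i))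

/-- The Hilbert bimodule `M°_{i₁} ⊗_B M°_{i₂} ⊗_B ⋯ ⊗_B M°_{iₙ}` of a word `i₁ i₂ … iₙ`. The tensor
products are bracketed to the right and end with the neutral factor `B`: the empty word gives `B`,
and a word of length one gives `M°_{i₁} ⊗_B B = M°_{i₁}`. -/
def wordBimodule : List I → HilbertBimodule.{u, u} B
  | [] => trivialBimodule B
  | i :: l => tensorBimodule (E i).ksgnsCirc (wordBimodule l)

variable (I) in
/-- Words `i₁ i₂ … iₙ` with `i₁ ≠ i₂, i₂ ≠ i₃, …`; the empty word is included. -/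
abbrev RedWord : Type w := {l : List I // l.IsChain (· ≠ ·)}

/-- Reduced words that do not begin with the letter `i`. -/
abbrev WordNot (i : I) : Type w := {l : RedWord I // ∀ j ∈ l.1.head?, i ≠ j}

/-- The reduced word obtained by putting the letter `i` in front. -/
def consWord (i : I) (l : WordNot i) : RedWord I := ⟨i :: l.1.1, List.isChain_cons.2 ⟨l.2, l.1.2⟩⟩

lemma consWord_ne (i : I) (k l : WordNot i) : consWord i k ≠ l.1 := by
  intro h
  refine l.2 i ?_ rfl
  rw [← h]
  rfl

lemma consWord_injective (i : I) : Function.Injective (consWord i) := fun k l h =>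
  Subtype.ext (Subtype.ext (List.cons_injective (congrArg Subtype.val h)))

/-- The free product Hilbert bimodule `M = B ⊕ ⨁ M°_{i₁} ⊗_B ⋯ ⊗_B M°_{iₙ}`, over all words with
`i₁ ≠ i₂, i₂ ≠ i₃, …`. -/
def fock : HilbertBimodule.{u, max u w} B := directSum fun l : RedWord I => wordBimodule E l.1

/-- The Hilbert bimodule `M(i) = B ⊕ ⨁ M°_{i₁} ⊗_B ⋯ ⊗_B M°_{iₙ}`, over all words with `i₁ ≠ i` and
`i₁ ≠ i₂, i₂ ≠ i₃, …`. -/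
def fockNot (i : I) : HilbertBimodule.{u, max u w} B :=
  directSum fun l : WordNot i => wordBimodule E l.1.1

/-- The summand of the free product module that belongs to a reduced word. -/
def wordIncl (l : RedWord I) : wordBimodule E l.1 →ₗ[ℂ] fock E :=
  incl (fun l : RedWord I => wordBimodule E l.1) l

/-- The summand of `M(i)` that belongs to a reduced word. -/
def wordNotIncl {i : I} (l : WordNot i) : wordBimodule E l.1.1 →ₗ[ℂ] fockNot E i :=
  incl (fun l : WordNot i => wordBimodule E l.1.1) l

/-- The vector `ξ = 1_B ∈ B ⊆ M`. -/
def vacuum : fock E := wordIncl E ⟨[], List.isChain_nil⟩ (1 : B)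

section V

variable (i : I)

variable {i} in
/-- The summand `M°_i ⊗_B (M°_{i₁} ⊗ ⋯ ⊗ M°_{iₙ})` of the free product module, where `i ≠ i₁`. -/
def consIncl (l : WordNot i) :
    tensorModule (E i).ksgnsCirc.mod (wordBimodule E l.1.1) →ₗ[ℂ] fock E :=
  wordIncl E (consWord i l)

/-- The part of `V_i` on `M_i ⊗ (M°_{i₁} ⊗ ⋯ ⊗ M°_{iₙ})`, namely `m ⊗ x ↦ ⟨ξ, m⟩ x + (P° m) ⊗ x`. -/
def vWord (l : WordNot i) : (E i).ksgns →ₗ[ℂ] wordBimodule E l.1.1 →ₗ[ℂ] fock E :=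
  LinearMap.mk₂ ℂ (fun m x =>
      wordIncl E l.1 ((wordBimodule E l.1.1).act ((E i).ksgns.ip (E i).ksgnsVec m) x)
        + consIncl E l
          (tmulₗ (E i).ksgnsCirc.mod (wordBimodule E l.1.1) ((E i).projCirc m) x))
    (fun m m' x => by
      rw [show (E i).ksgns.ip (E i).ksgnsVec (m + m') = _ from (E i).ksgns.inner.add_right _ _ _,
        HilbertBimodule.act_add, map_add, map_add, map_add, LinearMap.add_apply, map_add]
      exact add_add_add_comm _ _ _ _)
    (fun c m x => by
      rw [show (E i).ksgns.ip (E i).ksgnsVec (c • m) = _ from (E i).ksgns.inner.smul_right _ _ _,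
        HilbertBimodule.act_smul, map_smul, map_smul, map_smul, LinearMap.smul_apply, map_smul,
        smul_add])
    (fun m x x' => by
      rw [map_add, map_add, map_add, map_add]
      exact add_add_add_comm _ _ _ _)
    (fun c m x => by
      rw [map_smul, map_smul, map_smul, map_smul, smul_add])

lemma vWord_apply (l : WordNot i) (m : (E i).ksgns) (x : wordBimodule E l.1.1) :
    vWord E i l m x
      = wordIncl E l.1 ((wordBimodule E l.1.1).act ((E i).ksgns.ip (E i).ksgnsVec m) x)
        + consIncl E l (tmul ((E i).projCirc m) x) := rfl

end V

end FreeProduct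

section Extend

variable {B : Type u} [CStarAlgebra B] [PartialOrder B] [StarOrderedRing B]
  {V : Type v} [AddCommGroup V] [Module ℂ V] [Module Bᵐᵒᵖ V] (s : SemiInner B V)
  {Y : HilbertModule.{u, w} B}

/-- The extension to the completion of a linear map which preserves inner products. -/
def SemiInner.extendIso (f : V →ₗ[ℂ] Y) : s.hilbert →L[ℂ] Y := f.extendOfNorm s.toHilbert

variable (f : V →ₗ[ℂ] Y) (hf : ∀ x y, Y.ip (f x) (f y) = s.form x y)

lemma SemiInner.extendIso_apply (hf : ∀ x y, Y.ip (f x) (f y) = s.form x y)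
    (x : V) : s.extendIso f (s.toHilbert x) = f x :=
  LinearMap.extendOfNorm_eq s.denseRange_toHilbert ⟨1, fun x => by
    rw [one_mul]
    exact (HilbertModule.norm_eq_of_ip (X := Y) (Y := s.hilbert)
      ((hf x x).trans (s.ip_toHilbert x x).symm)).le⟩ x

lemma SemiInner.ip_extendIso (hf : ∀ x y, Y.ip (f x) (f y) = s.form x y)
    (x y : s.hilbert) :
    Y.ip (s.extendIso f x) (s.extendIso f y) = s.hilbert.ip x y := by
  have hc := (s.extendIso f).continuous
  induction x using s.hilbert_ind with
  | hp =>
    exact isClosed_eq (Y.ip_continuous hc continuous_const)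
      (s.hilbert.ip_continuous continuous_id continuous_const)
  | h x =>
  induction y using s.hilbert_ind with
  | hp =>
    exact isClosed_eq (Y.ip_continuous continuous_const hc)
      (s.hilbert.ip_continuous continuous_const continuous_id)
  | h y =>
  rw [s.extendIso_apply f hf, s.extendIso_apply f hf, s.ip_toHilbert, hf]

end Extend

section FreeProduct

variable {B : Type u} [CStarAlgebra B] [PartialOrder B] [StarOrderedRing B]
  {I : Type w} {A : I → Type u} [∀ i, CStarAlgebra (A i)] (E : ∀ i, CondExp B (A i)) (i : I)

/-- The algebraic direct sum inside `M(i)`. -/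
abbrev AlgNot : Type max u w := AlgSum fun l : WordNot i => wordBimodule E l.1.1

/-- The canonical map from the algebraic direct sum to `M(i)`. -/
def toNot : AlgNot E i →ₗ[ℂ] fockNot E i :=
  (AlgSum.semiInner fun l : WordNot i => wordBimodule E l.1.1).toHilbert

lemma toNot_single (l : WordNot i) (x : wordBimodule E l.1.1) :
    toNot E i (AlgSum.single (fun l : WordNot i => wordBimodule E l.1.1) l x)
      = wordNotIncl E l x := rfl

lemma denseRange_toNot : DenseRange (toNot E i) := SemiInner.denseRange_toHilbert _

/-- The map `x ↦ V_i (m ⊗ x)`, for `x` in the algebraic direct sum. -/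
def vAlg (m : (E i).ksgns) : AlgNot E i →ₗ[ℂ] fock E :=
  AlgSum.lift (fun l : WordNot i => wordBimodule E l.1.1) fun l => vWord E i l m

lemma vAlg_single (m : (E i).ksgns) (l : WordNot i) (x : wordBimodule E l.1.1) :
    vAlg E i m (AlgSum.single (fun l : WordNot i => wordBimodule E l.1.1) l x)
      = vWord E i l m x :=
  AlgSum.lift_single (fun l : WordNot i => wordBimodule E l.1.1) (fun l => vWord E i l m) l x

lemma vAlg_add (m m' : (E i).ksgns) : vAlg E i (m + m') = vAlg E i m + vAlg E i m' :=
  AlgSum.hom_ext _ fun l x => by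
    rw [LinearMap.add_apply, vAlg_single, vAlg_single, vAlg_single, map_add, LinearMap.add_apply]

lemma vAlg_smul (c : ℂ) (m : (E i).ksgns) : vAlg E i (c • m) = c • vAlg E i m :=
  AlgSum.hom_ext _ fun l x => by
    rw [LinearMap.smul_apply, vAlg_single, vAlg_single, map_smul, LinearMap.smul_apply]

lemma ip_wordIncl (l : RedWord I) (x y : wordBimodule E l.1) :
    (fock E).mod.ip (wordIncl E l x) (wordIncl E l y) = (wordBimodule E l.1).mod.ip x y :=
  ip_incl (F := fun l : RedWord I => wordBimodule E l.1) l x y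

lemma ip_wordIncl_of_ne {l k : RedWord I} (h : l ≠ k) (x : wordBimodule E l.1)
    (y : wordBimodule E k.1) : (fock E).mod.ip (wordIncl E l x) (wordIncl E k y) = 0 :=
  ip_incl_of_ne (F := fun l : RedWord I => wordBimodule E l.1) h x y

lemma ip_consIncl (l : WordNot i)
    (x y : tensorModule (E i).ksgnsCirc.mod (wordBimodule E l.1.1)) :
    (fock E).mod.ip (consIncl E l x) (consIncl E l y)
      = (tensorModule (E i).ksgnsCirc.mod (wordBimodule E l.1.1)).ip x y :=
  ip_wordIncl E (consWord i l) x y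

lemma ip_consIncl_of_ne {l k : WordNot i} (h : l ≠ k)
    (x : tensorModule (E i).ksgnsCirc.mod (wordBimodule E l.1.1))
    (y : tensorModule (E i).ksgnsCirc.mod (wordBimodule E k.1.1)) :
    (fock E).mod.ip (consIncl E l x) (consIncl E k y) = 0 :=
  ip_wordIncl_of_ne E (fun h' => h (consWord_injective i h')) x y

lemma ip_wordIncl_consIncl (l k : WordNot i) (x : wordBimodule E l.1.1)
    (y : tensorModule (E i).ksgnsCirc.mod (wordBimodule E k.1.1)) :
    (fock E).mod.ip (wordIncl E l.1 x) (consIncl E k y) = 0 :=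
  ip_wordIncl_of_ne E (consWord_ne i k l).symm x y

lemma ip_consIncl_wordIncl (l k : WordNot i)
    (x : tensorModule (E i).ksgnsCirc.mod (wordBimodule E l.1.1)) (y : wordBimodule E k.1.1) :
    (fock E).mod.ip (consIncl E l x) (wordIncl E k.1 y) = 0 :=
  ip_wordIncl_of_ne E (consWord_ne i l k) x y

lemma ip_wordNotIncl (l : WordNot i) (x y : wordBimodule E l.1.1) :
    (fockNot E i).mod.ip (wordNotIncl E l x) (wordNotIncl E l y)
      = (wordBimodule E l.1.1).mod.ip x y :=
  ip_incl (F := fun l : WordNot i => wordBimodule E l.1.1) l x y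

lemma ip_wordNotIncl_of_ne {l k : WordNot i} (h : l ≠ k) (x : wordBimodule E l.1.1)
    (y : wordBimodule E k.1.1) :
    (fockNot E i).mod.ip (wordNotIncl E l x) (wordNotIncl E k y) = 0 :=
  ip_incl_of_ne (F := fun l : WordNot i => wordBimodule E l.1.1) h x y

lemma act_wordNotIncl (l : WordNot i) (b : B) (x : wordBimodule E l.1.1) :
    (fockNot E i).act b (wordNotIncl E l x) = wordNotIncl E l ((wordBimodule E l.1.1).act b x) :=
  act_incl (F := fun l : WordNot i => wordBimodule E l.1.1) l b x

lemma ip_add_add (X : HilbertModule.{u, v} B) (x y z t : X) :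
    X.ip (x + y) (z + t) = X.ip x z + X.ip x t + X.ip y z + X.ip y t := by
  simp only [HilbertModule.ip, X.inner.add_left, X.inner.add_right]
  abel

lemma ip_vWord (l k : WordNot i) (m m' : (E i).ksgns) (x : wordBimodule E l.1.1)
    (y : wordBimodule E k.1.1) :
    (fock E).mod.ip (vWord E i l m x) (vWord E i k m' y)
      = (fockNot E i).mod.ip (wordNotIncl E l x)
          ((fockNot E i).act ((E i).ksgns.ip m m') (wordNotIncl E k y)) := by
  rw [act_wordNotIncl, vWord_apply, vWord_apply, ip_add_add,
    ip_wordIncl_consIncl, ip_consIncl_wordIncl]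
  by_cases h : l = k
  · subst h
    rw [ip_wordNotIncl, ip_wordIncl, ip_consIncl, ip_tmul, HilbertBimodule.ip_act, (E i).ip_decomp m m',
      HilbertBimodule.act_add, HilbertBimodule.act_mul]
    refine Eq.trans ?_ ((wordBimodule E l.1.1).mod.inner.add_right _ _ _).symm
    rw [add_zero, add_zero]
  · rw [ip_wordNotIncl_of_ne E i h, ip_wordIncl_of_ne E fun h' => h (Subtype.ext h'),
      ip_consIncl_of_ne E i h, add_zero, add_zero, add_zero]

lemma ip_vAlg (m m' : (E i).ksgns) (x y : AlgNot E i) :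
    (fock E).mod.ip (vAlg E i m x) (vAlg E i m' y)
      = (fockNot E i).mod.ip (toNot E i x)
          ((fockNot E i).act ((E i).ksgns.ip m m') (toNot E i y)) := by
  have hr : ∀ (X : HilbertModule.{u, max u w} B) (x y z : X),
    X.ip x (y + z) = X.ip x y + X.ip x z := fun X => X.inner.add_right
  have hl : ∀ (X : HilbertModule.{u, max u w} B) (x y z : X),
    X.ip (x + y) z = X.ip x z + X.ip y z := fun X => X.inner.add_left
  have hr0 : ∀ (X : HilbertModule.{u, max u w} B) (x : X), X.ip x 0 = 0 :=
    fun X => X.inner.zero_right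
  have hl0 : ∀ (X : HilbertModule.{u, max u w} B) (x : X), X.ip 0 x = 0 :=
    fun X => X.inner.zero_left
  induction x using AlgSum.ind with
  | h0 => rw [map_zero, map_zero, hl0, hl0]
  | hadd x x' hx hx' => rw [map_add, map_add, hl, hl, hx, hx']
  | h l x =>
  induction y using AlgSum.ind with
  | h0 => rw [map_zero, map_zero, map_zero, hr0, hr0]
  | hadd y y' hy hy' => rw [map_add, map_add, map_add, hr, hr, hy, hy']
  | h k y =>
  rw [vAlg_single, vAlg_single, toNot_single, toNot_single, ip_vWord]

lemma exists_bound (m : (E i).ksgns) :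
    ∃ C, ∀ x, ‖vAlg E i m x‖ ≤ C * ‖toNot E i x‖ := by
  set T := (fockNot E i).act ((E i).ksgns.ip m m) with hT
  refine ⟨√‖T‖, fun x => le_of_sq_le_sq ?_ (by positivity)⟩
  rw [mul_pow, Real.sq_sqrt (norm_nonneg _), (fock E).mod.norm_sq]
  calc ‖(fock E).mod.ip (vAlg E i m x) (vAlg E i m x)‖
      = ‖(fockNot E i).mod.ip (toNot E i x) (T (toNot E i x))‖ := by rw [ip_vAlg]
    _ ≤ ‖toNot E i x‖ * ‖T (toNot E i x)‖ := (fockNot E i).mod.norm_ip_le _ _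
    _ ≤ ‖toNot E i x‖ * (‖T‖ * ‖toNot E i x‖) := by
        gcongr; exact T.le_opNorm _
    _ = _ := by ring

/-- The map `x ↦ V_i (m ⊗ x)` on `M(i)`. -/
def vFix (m : (E i).ksgns) : fockNot E i →L[ℂ] fock E := (vAlg E i m).extendOfNorm (toNot E i)

lemma vFix_toNot (m : (E i).ksgns) (x : AlgNot E i) :
    vFix E i m (toNot E i x) = vAlg E i m x :=
  LinearMap.extendOfNorm_eq (denseRange_toNot E i) (exists_bound E i m) x

lemma not_ind {p : fockNot E i → Prop} (x : fockNot E i) (hp : IsClosed {x | p x})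
    (h : ∀ v, p (toNot E i v)) : p x :=
  SemiInner.hilbert_ind _ x hp h

lemma vFix_add (m m' : (E i).ksgns) (x : fockNot E i) :
    vFix E i (m + m') x = vFix E i m x + vFix E i m' x := by
  induction x using not_ind with
  | hp => exact isClosed_eq (by fun_prop) (by fun_prop)
  | h x => rw [vFix_toNot, vFix_toNot, vFix_toNot, vAlg_add, LinearMap.add_apply]

lemma vFix_smul (c : ℂ) (m : (E i).ksgns) (x : fockNot E i) :
    vFix E i (c • m) x = c • vFix E i m x := by
  induction x using not_ind with
  | hp =>
    exact isClosed_eq (vFix E i (c • m)).continuous ((vFix E i m).continuous.const_smul c)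
  | h x => rw [vFix_toNot, vFix_toNot, vAlg_smul, LinearMap.smul_apply]

lemma ip_vFix (m m' : (E i).ksgns) (x y : fockNot E i) :
    (fock E).mod.ip (vFix E i m x) (vFix E i m' y)
      = (fockNot E i).mod.ip x ((fockNot E i).act ((E i).ksgns.ip m m') y) := by
  induction x using not_ind with
  | hp =>
    exact isClosed_eq ((fock E).mod.ip_continuous (vFix E i m).continuous continuous_const)
      ((fockNot E i).mod.ip_continuous continuous_id continuous_const)
  | h x =>
  induction y using not_ind with
  | hp =>
    exact isClosed_eq ((fock E).mod.ip_continuous continuous_const (vFix E i m').continuous)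
      ((fockNot E i).mod.ip_continuous continuous_const
        ((fockNot E i).act ((E i).ksgns.ip m m')).continuous)
  | h y => rw [vFix_toNot, vFix_toNot, ip_vAlg]

/-- The restriction of `V_i` to the algebraic tensor product. -/
def vTen : AlgTensor (E i).ksgns (fockNot E i) →ₗ[ℂ] fock E :=
  TensorProduct.lift <| LinearMap.mk₂ ℂ (fun m x => vFix E i m x) (vFix_add E i) (vFix_smul E i)
    (fun m => map_add (vFix E i m)) (fun c m => map_smul (vFix E i m) c)

lemma vTen_tmul (m : (E i).ksgns) (x : fockNot E i) :
    vTen E i (AlgTensor.tmul m x) = vFix E i m x := rfl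

lemma ip_vTen (s t : AlgTensor (E i).ksgns (fockNot E i)) :
    (fock E).mod.ip (vTen E i s) (vTen E i t)
      = (AlgTensor.semiInner (E i).ksgns (fockNot E i)).form s t := by
  have hr : ∀ (X : HilbertModule.{u, max u w} B) (x y z : X),
    X.ip x (y + z) = X.ip x y + X.ip x z := fun X => X.inner.add_right
  have hl : ∀ (X : HilbertModule.{u, max u w} B) (x y z : X),
    X.ip (x + y) z = X.ip x z + X.ip y z := fun X => X.inner.add_left
  have hr0 : ∀ (X : HilbertModule.{u, max u w} B) (x : X), X.ip x 0 = 0 :=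
    fun X => X.inner.zero_right
  have hl0 : ∀ (X : HilbertModule.{u, max u w} B) (x : X), X.ip 0 x = 0 :=
    fun X => X.inner.zero_left
  induction s using AlgTensor.ind with
  | h0 => rw [map_zero, hl0, SemiInner.zero_left]
  | hadd s s' hs hs' => rw [map_add, hl, SemiInner.add_left, hs, hs']
  | h m x =>
  induction t using AlgTensor.ind with
  | h0 => rw [map_zero, hr0, SemiInner.zero_right]
  | hadd t t' ht ht' => rw [map_add, hr, SemiInner.add_right, ht, ht']
  | h m' y =>
  rw [vTen_tmul, vTen_tmul, ip_vFix]
  rfl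

/-- The map `V_i : M_i ⊗_B M(i) → M`. -/
def vMap : tensorModule (E i).ksgns (fockNot E i) →L[ℂ] fock E :=
  (AlgTensor.semiInner (E i).ksgns (fockNot E i)).extendIso (vTen E i)

lemma ip_vMap (s t : tensorModule (E i).ksgns (fockNot E i)) :
    (fock E).mod.ip (vMap E i s) (vMap E i t) = (tensorModule (E i).ksgns (fockNot E i)).ip s t :=
  SemiInner.ip_extendIso _ _ (ip_vTen E i) s t

/-- `V_i (m ⊗ x) = ⟨ξ, m⟩ x + (P° m) ⊗ x`. -/
lemma vMap_tmul (m : (E i).ksgns) (l : WordNot i) (x : wordBimodule E l.1.1) :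
    vMap E i (tmul (N := fockNot E i) m (wordNotIncl E l x))
      = wordIncl E l.1 ((wordBimodule E l.1.1).act ((E i).ksgns.ip (E i).ksgnsVec m) x)
        + consIncl E l (tmul ((E i).projCirc m) x) := by
  refine (SemiInner.extendIso_apply _ _ (ip_vTen E i) _).trans ?_
  rw [vTen_tmul, ← toNot_single, vFix_toNot, vAlg_single, vWord_apply]

/-- `V_i` as a linear isometry. -/
def vIso : tensorModule (E i).ksgns (fockNot E i) →ₗᵢ[ℂ] fock E where
  toLinearMap := (vMap E i).toLinearMap
  norm_map' x := HilbertModule.norm_eq_of_ip (ip_vMap E i x x)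

lemma wordIncl_mem (k : RedWord I) (x : wordBimodule E k.1) :
    wordIncl E k x ∈ Set.range (vIso E i) := by
  by_cases h : ∀ j ∈ k.1.head?, i ≠ j
  · let l : WordNot i := ⟨k, h⟩
    refine ⟨tmul (N := fockNot E i) (E i).ksgnsVec (wordNotIncl E l x), ?_⟩
    refine (vMap_tmul E i _ l x).trans ?_
    rw [(E i).ip_vec_vec, HilbertBimodule.act_one, (E i).projCirc_vec]
    refine (congrArg (wordIncl E k x + ·) ?_).trans (add_zero _)
    refine Eq.trans (congrArg _ ?_) (map_zero (consIncl E l))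
    exact LinearMap.congr_fun (map_zero (tmulₗ (E i).ksgnsCirc.mod (wordBimodule E l.1.1))) x
  · obtain ⟨⟨⟩ | ⟨j, l⟩, hk⟩ := k
    · simp at h
    obtain rfl : i = j := by simpa using h
    have hk' := List.isChain_cons.1 hk
    let l' : WordNot i := ⟨⟨l, hk'.2⟩, hk'.1⟩
    have hcl : IsClosed (Set.range (vIso E i)) := (vIso E i).isometry.isClosedEmbedding.isClosed_range
    have hc : Continuous (consIncl E l') :=
      (LinearIsometry.mk (consIncl E l') fun x =>
        HilbertModule.norm_eq_of_ip (ip_consIncl E i l' x x)).continuous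
    change consIncl E l' x ∈ _
    refine SemiInner.hilbert_ind (AlgTensor.semiInner (E i).ksgnsCirc.mod (wordBimodule E l))
      (p := fun x => consIncl E l' x ∈ Set.range (vIso E i)) x (hcl.preimage hc) fun v => ?_
    induction v using AlgTensor.ind with
    | h0 =>
      refine ⟨0, (map_zero _).trans ?_⟩
      rw [map_zero]
      exact (map_zero (consIncl E l')).symm
    | hadd s t hs ht =>
      obtain ⟨a, ha⟩ := hs
      obtain ⟨b, hb⟩ := ht
      refine ⟨a + b, ?_⟩
      rw [map_add, ha, hb, map_add]
      exact (map_add (consIncl E l') _ _).symm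
    | h z y =>
      refine ⟨tmul (N := fockNot E i) ((E i).circIncl z) (wordNotIncl E l' y), ?_⟩
      refine (vMap_tmul E i _ l' y).trans ?_
      rw [(E i).ip_vec_circ, HilbertBimodule.act_zero, (E i).projCirc_circ, map_zero, zero_add]
      rfl

lemma vIso_surjective : Function.Surjective (vIso E i) := by
  have hcl : IsClosed (Set.range (vIso E i)) := (vIso E i).isometry.isClosedEmbedding.isClosed_range
  intro x
  refine SemiInner.hilbert_ind (AlgSum.semiInner fun l : RedWord I => wordBimodule E l.1)
    (p := fun x => x ∈ Set.range (vIso E i)) x hcl fun v => ?_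
  induction v using AlgSum.ind with
  | h0 => exact ⟨0, (map_zero _).trans (map_zero _).symm⟩
  | hadd s t hs ht =>
    obtain ⟨a, ha⟩ := hs
    obtain ⟨b, hb⟩ := ht
    refine ⟨a + b, ?_⟩
    rw [map_add, ha, hb, map_add]
    rfl
  | h l y => exact wordIncl_mem E i l y

/-- The unitary operator `V_i : M_i ⊗_B M(i) → M`. -/
def vUnitary : tensorModule (E i).ksgns (fockNot E i) ≃L[ℂ] fock E :=
  (LinearIsometryEquiv.ofSurjective (vIso E i) (vIso_surjective E i)).toContinuousLinearEquiv

lemma ip_vUnitary (s t : tensorModule (E i).ksgns (fockNot E i)) :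
    (fock E).mod.ip (vUnitary E i s) (vUnitary E i t)
      = (tensorModule (E i).ksgns (fockNot E i)).ip s t := ip_vMap E i s t

/-- The representation `λ_i : A_i → 𝓛(M)`, `a ↦ V_i (π_i(a) ⊗ 1) V_i*`. -/
def lambda : A i →⋆ₐ[ℂ] Adj (fock E).mod :=
  (conjUnitary (vUnitary E i) (ip_vUnitary E i)).comp
    ((tensorOne (E i).ksgns (fockNot E i)).comp (E i).ksgnsRep)

/-- The reduced amalgamated free product: the C⋆-subalgebra of `𝓛(M)` generated by the images of
all `λ_i`. -/
def reducedFreeProduct : StarSubalgebra ℂ (Adj (fock E).mod) :=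
  (StarAlgebra.adjoin ℂ (⋃ i, Set.range (lambda E i))).topologicalClosure

/-- The map `x ↦ ⟨ξ, x ξ⟩` from the reduced amalgamated free product to `B`. -/
def freeE : reducedFreeProduct E →ₗ[ℂ] B where
  toFun x := (fock E).mod.ip (vacuum E) (x.1.1 (vacuum E))
  map_add' x y := (fock E).mod.inner.add_right _ _ _
  map_smul' c x := (fock E).mod.inner.smul_right _ _ _

end FreeProduct

/-- States on a unital C⋆-algebra. -/
structure IsState {A : Type u} [CStarAlgebra A] (φ : A →ₗ[ℂ] ℂ) : Prop where
  map_one : φ 1 = 1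
  map_nonneg : ∀ a, 0 ≤ φ (star a * a)

end
end FreeProd

namespace FreeProd

open scoped ComplexOrder TensorProduct
open MulOpposite

section FaithfulFreeProduct

set_option linter.unusedSectionVars false

variable {B : Type u} [CStarAlgebra B] [PartialOrder B] [StarOrderedRing B]

lemma Adj.mul_apply {X : HilbertModule.{u, v} B} (S T : Adj X) (x : X) :
    (S * T).1 x = S.1 (T.1 x) := rfl

lemma Adj.add_apply {X : HilbertModule.{u, v} B} (S T : Adj X) (x : X) :
    (S + T).1 x = S.1 x + T.1 x := rfl

lemma HilbertModule.eq_zero_of_ip_self (X : HilbertModule.{u, v} B) {x : X} (h : X.ip x x = 0) :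
    x = 0 := by
  have h1 := X.norm_sq x
  rw [show X.inner.form x x = 0 from h, norm_zero] at h1
  simpa using h1

lemma norm_tmul_le {M : HilbertModule.{u, v} B} {N : HilbertBimodule.{u, w} B} (m : M) (n : N) :
    ‖tmul m n‖ ≤ ‖n‖ * ‖m‖ := by
  refine le_of_sq_le_sq ?_ (by positivity)
  have h1 : ‖N.act (M.ip m m)‖ ≤ ‖M.ip m m‖ := NonUnitalStarAlgHom.norm_apply_le N.left _
  calc ‖tmul m n‖ ^ 2 = ‖(tensorModule M N).ip (tmul m n) (tmul m n)‖ :=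
        (tensorModule M N).norm_sq _
    _ = ‖N.mod.ip n (N.act (M.ip m m) n)‖ := by rw [ip_tmul]
    _ ≤ ‖n‖ * ‖N.act (M.ip m m) n‖ := N.mod.norm_ip_le _ _
    _ ≤ ‖n‖ * (‖M.ip m m‖ * ‖n‖) := by
        gcongr; exact ContinuousLinearMap.le_of_opNorm_le _ h1 n
    _ = ‖n‖ * (‖m‖ ^ 2 * ‖n‖) := by rw [M.norm_sq]
    _ = (‖n‖ * ‖m‖) ^ 2 := by ring

lemma continuous_tmul_left {M : HilbertModule.{u, v} B} {N : HilbertBimodule.{u, w} B} (n : N) :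
    Continuous fun m : M => tmul m n :=
  (((tmulₗ M N).flip n).mkContinuous ‖n‖ fun m => norm_tmul_le m n).continuous

namespace CondExp

variable {A : Type v} [CStarAlgebra A] (E : CondExp B A)

lemma projCirc_hat_embed (b : B) : E.projCirc (E.hat (E.embed b)) = 0 := Subtype.ext <| by
  change E.hat (E.embed b) - op (E.ksgns.ip (E.hat 1) (E.hat (E.embed b))) • E.hat 1 = 0
  rw [ip_hat, star_one, one_mul, map_embed, hat_rsmul, one_mul, sub_self]

lemma ip_vec_hat (a : A) : E.ksgns.ip E.ksgnsVec (E.hat a) = E.map a := by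
  rw [ksgnsVec, ip_hat, star_one, one_mul]

lemma map_sub_embed (a : A) : E.map (a - E.embed (E.map a)) = 0 := by
  rw [map_sub, map_embed, sub_self]

lemma hat_eq_zero (hE : IsFaithful E.map) {a : A} (h : E.hat a = 0) : a = 0 := by
  refine hE a ?_
  rw [← ip_hat, h]
  exact E.ksgns.inner.zero_right 0

/-- The representation on `L²(A, E)` is isometric when `E` is faithful. -/
lemma norm_ksgnsRep (hE : IsFaithful E.map) (a : A) : ‖E.ksgnsRep a‖ = ‖a‖ := by
  refine NonUnitalStarAlgHom.norm_map E.ksgnsRep ?_ a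
  refine (injective_iff_map_eq_zero E.ksgnsRep).2 fun c hc => ?_
  refine E.hat_eq_zero hE ?_
  have h := E.ksgnsRep_hat c 1
  rw [hc, mul_one] at h
  exact h.symm

lemma hat_ind {p : E.ksgns → Prop} (m : E.ksgns) (hp : IsClosed {m | p m})
    (h : ∀ a, p (E.hat a)) : p m := E.semiInner.hilbert_ind m hp h

end CondExp

variable {I : Type w} {A : I → Type u} [∀ i, CStarAlgebra (A i)] (E : ∀ i, CondExp B (A i))

lemma lambda_vMap (i : I) (a : A i) (m : (E i).ksgns) (x : fockNot E i) :
    (lambda E i a).1 (vMap E i (tmul m x)) = vMap E i (tmul (((E i).ksgnsRep a).1 m) x) := by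
  refine (conjUnitary_apply (vUnitary E i) (ip_vUnitary E i) _ _).trans ?_
  exact congrArg (vMap E i) (tensorOne_tmul _ (fockNot E i) ((E i).ksgnsRep a) m x)

lemma vMap_vec_tmul {i : I} (l : WordNot i) (x : wordBimodule E l.1.1) :
    vMap E i (tmul (N := fockNot E i) (E i).ksgnsVec (wordNotIncl E l x)) = wordIncl E l.1 x := by
  refine (vMap_tmul E i _ l x).trans ?_
  rw [(E i).ip_vec_vec, HilbertBimodule.act_one, (E i).projCirc_vec]
  refine (congrArg (wordIncl E l.1 x + ·) ?_).trans (add_zero _)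
  refine Eq.trans (congrArg _ ?_) (map_zero (consIncl E l))
  exact LinearMap.congr_fun (map_zero (tmulₗ (E i).ksgnsCirc.mod (wordBimodule E l.1.1))) x

lemma vMap_circ_tmul {i : I} (l : WordNot i) (z : (E i).ksgnsCirc) (x : wordBimodule E l.1.1) :
    vMap E i (tmul (N := fockNot E i) ((E i).circIncl z) (wordNotIncl E l x))
      = consIncl E l (tmul z x) := by
  refine (vMap_tmul E i _ l x).trans ?_
  rw [(E i).ip_vec_circ, HilbertBimodule.act_zero, (E i).projCirc_circ, map_zero, zero_add]

/-- `λ_i(a) x = E_i(a) x + (P° â) ⊗ x` for `x` in the summand of a word not beginning with `i`. -/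
lemma lambda_wordIncl {i : I} (a : A i) (l : WordNot i) (x : wordBimodule E l.1.1) :
    (lambda E i a).1 (wordIncl E l.1 x)
      = wordIncl E l.1 ((wordBimodule E l.1.1).act ((E i).map a) x)
        + consIncl E l (tmul ((E i).projCirc ((E i).hat a)) x) := by
  rw [← vMap_vec_tmul E l x]
  refine (lambda_vMap E i a _ _).trans ?_
  rw [CondExp.ksgnsVec, CondExp.ksgnsRep_hat, mul_one]
  refine (vMap_tmul E i _ l x).trans ?_
  rw [CondExp.ip_vec_hat]

lemma consIncl_ind {i : I} (l : WordNot i) {S : Set (fock E)}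
    (hS : IsClosed S) (h0 : 0 ∈ S) (hadd : ∀ x ∈ S, ∀ y ∈ S, x + y ∈ S)
    (h : ∀ z y, consIncl E l (tmul z y) ∈ S)
    (x : tensorModule (E i).ksgnsCirc.mod (wordBimodule E l.1.1)) : consIncl E l x ∈ S := by
  have hc : Continuous (consIncl E l) :=
    (LinearIsometry.mk (consIncl E l) fun x =>
      HilbertModule.norm_eq_of_ip (ip_consIncl E i l x x)).continuous
  refine SemiInner.hilbert_ind (AlgTensor.semiInner (E i).ksgnsCirc.mod (wordBimodule E l.1.1))
    (p := fun x => consIncl E l x ∈ S) x (hS.preimage hc) fun v => ?_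
  induction v using AlgTensor.ind with
  | h0 =>
    rw [map_zero]
    exact (map_zero (consIncl E l)).symm ▸ h0
  | hadd s t hs ht =>
    rw [map_add]
    exact (map_add (consIncl E l) _ _).symm ▸ hadd _ hs _ ht
  | h z y => exact h z y

/-- Two operators that agree on the summands of all reduced words are equal. -/
lemma fock_clm_ext {S T : fock E →L[ℂ] fock E}
    (h : ∀ k x, S (wordIncl E k x) = T (wordIncl E k x)) : S = T := by
  refine SemiInner.clm_ext _ fun v => ?_
  induction v using AlgSum.ind with
  | h0 => exact (map_zero S).trans (map_zero T).symm
  | hadd x y hx hy =>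
    rw [map_add]
    exact (map_add S _ _).trans ((congrArg₂ _ hx hy).trans (map_add T _ _).symm)
  | h l y => exact h l y

/-- The representations `λ_i` agree on `B` with the left action. -/
lemma lambda_embed (i : I) (b : B) : lambda E i ((E i).embed b) = (fock E).left b := by
  refine Subtype.ext (fock_clm_ext E fun k x => ?_)
  have hact : ((fock E).left b).1 (wordIncl E k x)
      = wordIncl E k ((wordBimodule E k.1).act b x) :=
    act_incl (F := fun l : RedWord I => wordBimodule E l.1) k b x
  by_cases h : ∀ j ∈ k.1.head?, i ≠ j
  · let l : WordNot i := ⟨k, h⟩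
    refine (lambda_wordIncl E _ l x).trans ?_
    rw [hact, CondExp.map_embed, CondExp.projCirc_hat_embed]
    refine (congrArg (wordIncl E k _ + ·) ?_).trans (add_zero _)
    refine Eq.trans (congrArg _ ?_) (map_zero (consIncl E l))
    exact LinearMap.congr_fun (map_zero (tmulₗ (E i).ksgnsCirc.mod (wordBimodule E l.1.1))) x
  · clear hact
    obtain ⟨⟨⟩ | ⟨j, l⟩, hk⟩ := k
    · simp at h
    obtain rfl : i = j := by simpa using h
    have hk' := List.isChain_cons.1 hk
    let l' : WordNot i := ⟨⟨l, hk'.2⟩, hk'.1⟩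
    refine consIncl_ind E l' (S := {y | (lambda E i ((E i).embed b)).1 y = ((fock E).left b).1 y})
      (isClosed_eq (ContinuousLinearMap.continuous _) (ContinuousLinearMap.continuous _))
      ((map_zero _).trans (map_zero _).symm)
      (fun x hx y hy => (map_add _ _ _).trans ((congrArg₂ _ hx hy).trans (map_add _ _ _).symm))
      (fun z y => ?_) x
    have hact : ((fock E).left b).1 (consIncl E l' (tmul z y))
        = consIncl E l' (tmul ((E i).ksgnsCirc.act b z) y) :=
      (act_incl (F := fun l : RedWord I => wordBimodule E l.1) (consWord i l') b _).trans
        (congrArg (consIncl E l') (tensorOne_tmul _ _ _ _ _))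
    refine Eq.trans ?_ hact.symm
    rw [← vMap_circ_tmul, ← vMap_circ_tmul]
    exact lambda_vMap E i _ _ _

/-- The empty word, as a reduced word not beginning with `i`. -/
def emptyWord (i : I) : WordNot i := ⟨⟨[], List.isChain_nil⟩, fun j hj => by simp at hj⟩

/-- The isometry `m ↦ V_i (m ⊗ ξ)` of `L²(A_i, E_i)` onto `ξB ⊕ M°_i`. -/
noncomputable def vacFix (i : I) (m : (E i).ksgns) : fock E :=
  vMap E i (tmul (N := fockNot E i) m (wordNotIncl E (emptyWord i) (1 : B)))

lemma vacFix_eq (i : I) (m : (E i).ksgns) : vacFix E i m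
    = wordIncl E (emptyWord i).1
        ((wordBimodule E (emptyWord i).1.1).act ((E i).ksgns.ip (E i).ksgnsVec m) (1 : B))
      + consIncl E (emptyWord i)
        (tmul (N := wordBimodule E (emptyWord i).1.1) ((E i).projCirc m) (1 : B)) :=
  vMap_tmul E i m (emptyWord i) _

lemma ip_vacFix (i : I) (m m' : (E i).ksgns) :
    (fock E).mod.ip (vacFix E i m) (vacFix E i m') = (E i).ksgns.ip m m' := by
  refine (ip_vMap E i _ _).trans ((ip_tmul _ _ _ _ _ _).trans ?_)
  refine (congrArg _ (act_wordNotIncl E i (emptyWord i) _ _)).trans ?_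
  refine (ip_wordNotIncl E i (emptyWord i) _ _).trans ?_
  change star (1 : B) * ((E i).ksgns.ip m m' * 1) = _
  rw [star_one, one_mul, mul_one]

lemma norm_vacFix (i : I) (m : (E i).ksgns) : ‖vacFix E i m‖ = ‖m‖ :=
  HilbertModule.norm_eq_of_ip (ip_vacFix E i m m)

lemma vacFix_vec (i : I) : vacFix E i (E i).ksgnsVec = vacuum E :=
  vMap_vec_tmul E (emptyWord i) _

lemma lambda_vacFix (i : I) (a : A i) (m : (E i).ksgns) :
    (lambda E i a).1 (vacFix E i m) = vacFix E i (((E i).ksgnsRep a).1 m) :=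
  lambda_vMap E i a _ _

lemma lambda_vacuum (i : I) (a : A i) :
    (lambda E i a).1 (vacuum E) = vacFix E i ((E i).hat a) := by
  rw [← vacFix_vec E i, lambda_vacFix, CondExp.ksgnsVec, CondExp.ksgnsRep_hat, mul_one]

/-- The maps `m ↦ λ_{i₁}(a₁) ⋯ λ_{iₙ}(aₙ) V_i (π_i(c) m ⊗ ξ)` with `E_{iₖ}(aₖ) = 0` for which the
word `i₁ … iₙ i` is reduced. -/
inductive ReducedMap (i : I) : List I → ((E i).ksgns → fock E) → Prop
  | base (c : A i) : ReducedMap i [] fun m => vacFix E i (((E i).ksgnsRep c).1 m)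
  | cons (j : I) (l : List I) (a : A j) (f : (E i).ksgns → fock E) (ha : (E j).map a = 0)
      (hj : ∀ k ∈ (l ++ [i]).head?, j ≠ k) (hf : ReducedMap i l f) :
      ReducedMap i (j :: l) fun m => (lambda E j a).1 (f m)

variable {E}

lemma ReducedMap.isChain {i : I} {l : List I} {f : (E i).ksgns → fock E}
    (hf : ReducedMap E i l f) : (l ++ [i]).IsChain (· ≠ ·) := by
  induction hf with
  | base c => simp
  | cons j l a f ha hj hf ih => exact List.isChain_cons.2 ⟨hj, ih⟩

lemma ReducedMap.act {i : I} {l : List I} {f : (E i).ksgns → fock E}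
    (hf : ReducedMap E i l f) (b : B) : ReducedMap E i l fun m => ((fock E).left b).1 (f m) := by
  cases hf with
  | base c =>
    convert ReducedMap.base (E := E) ((E i).embed b * c) using 2 with m
    rw [← lambda_embed E i, lambda_vacFix, map_mul]
    rfl
  | cons j l a f ha hj hf =>
    convert ReducedMap.cons j l ((E j).embed b * a) f ?_ hj hf using 2 with m
    · rw [← lambda_embed E j, map_mul]
      rfl
    · rw [CondExp.map_embed_mul, ha, mul_zero]

lemma ReducedMap.exists_eq_add {i : I} {l : List I} {f : (E i).ksgns → fock E}
    (hf : ReducedMap E i l f) (m : (E i).ksgns) :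
    ∃ (x : wordBimodule E l) (y : wordBimodule E (l ++ [i])),
      f m = wordIncl E ⟨l, hf.isChain.left_of_append⟩ x
        + wordIncl E ⟨l ++ [i], hf.isChain⟩ y := by
  induction hf with
  | base c => exact ⟨_, _, vacFix_eq E i _⟩
  | cons j l a f ha hj hf ih =>
    obtain ⟨x, y, h⟩ := ih
    have hc := hf.isChain
    have hj' : ∀ k ∈ l.head?, j ≠ k := fun k hk => hj k (by
      cases l with
      | nil => simp at hk
      | cons a l => simpa using hk)
    have key : ∀ (k : WordNot j) (x : wordBimodule E k.1.1),
        (lambda E j a).1 (wordIncl E k.1 x)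
          = consIncl E k (tmul ((E j).projCirc ((E j).hat a)) x) := fun k x => by
      rw [lambda_wordIncl, ha, HilbertBimodule.act_zero, map_zero, zero_add]
    refine ⟨tmul ((E j).projCirc ((E j).hat a)) x, tmul ((E j).projCirc ((E j).hat a)) y, ?_⟩
    refine (congrArg (lambda E j a).1 h).trans ((map_add _ _ _).trans ?_)
    exact congrArg₂ (· + ·) (key ⟨⟨l, hc.left_of_append⟩, hj'⟩ x) (key ⟨⟨l ++ [i], hc⟩, hj⟩ y)

lemma ReducedMap.ip_vacFix_eq_zero {i : I} {l : List I} {f : (E i).ksgns → fock E}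
    (hf : ReducedMap E i l f) (hl : l ≠ []) (m m' : (E i).ksgns) :
    (fock E).mod.ip (vacFix E i m) (f m') = 0 := by
  obtain ⟨x, y, h⟩ := hf.exists_eq_add m'
  rw [h, vacFix_eq, ip_add_add]
  have h1 : l ≠ [i] := by
    rintro rfl
    simpa using hf.isChain
  refine (congrArg₂ (· + ·) (congrArg₂ (· + ·) (congrArg₂ (· + ·)
    (ip_wordIncl_of_ne E (fun h => hl ?_) _ _) (ip_wordIncl_of_ne E (fun h => ?_) _ _))
    (ip_wordIncl_of_ne E (fun h => h1 ?_) _ _)) (ip_wordIncl_of_ne E (fun h => hl ?_) _ _)).trans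
    (by simp)
  · exact (congrArg Subtype.val h).symm
  · have := congrArg Subtype.val h
    simp [emptyWord] at this
  · exact (congrArg Subtype.val h).symm
  · have := congrArg Subtype.val h
    simpa [emptyWord, consWord] using this

variable (E)

/-- The linear span of the maps in `ReducedMap`. -/
noncomputable def reducedMaps (i : I) : Submodule ℂ ((E i).ksgns → fock E) :=
  Submodule.span ℂ {f | ∃ l, ReducedMap E i l f}

variable {E}

lemma ReducedMap.lambda_mem {i j : I} {l : List I} {f : (E i).ksgns → fock E}
    (hf : ReducedMap E i l f) (a : A j) :
    (fun m => (lambda E j a).1 (f m)) ∈ reducedMaps E i := by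
  have key : ∀ {l : List I} {f : (E i).ksgns → fock E}, ReducedMap E i l f →
      (∀ k ∈ (l ++ [i]).head?, j ≠ k) → ∀ a : A j,
      (fun m => (lambda E j a).1 (f m)) ∈ reducedMaps E i := by
    intro l f hf hj a
    have h1 := Submodule.subset_span (R := ℂ) (s := {f | ∃ l, ReducedMap E i l f})
      ⟨_, ReducedMap.cons j l _ f ((E j).map_sub_embed a) hj hf⟩
    have h2 := Submodule.subset_span (R := ℂ) (s := {f | ∃ l, ReducedMap E i l f})
      ⟨_, hf.act ((E j).map a)⟩
    refine (congrArg (· ∈ reducedMaps E i) (funext fun m => ?_)).mp (Submodule.add_mem _ h1 h2)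
    rw [Pi.add_apply, ← lambda_embed E j, ← Adj.add_apply, ← map_add, sub_add_cancel]
  by_cases hj : ∀ k ∈ (l ++ [i]).head?, j ≠ k
  · exact key hf hj a
  cases hf with
  | base c =>
    obtain rfl : j = i := by simpa using hj
    refine Submodule.subset_span ⟨[], ?_⟩
    convert ReducedMap.base (E := E) (a * c) using 2 with m
    rw [lambda_vacFix, map_mul]
    rfl
  | cons k l b f hb hk hf =>
    obtain rfl : j = k := by simpa using hj
    convert key hf hk (a * b) using 2 with m
    rw [map_mul]
    rfl

lemma adjoin_comp_mem_reducedMaps {i : I} {T : Adj (fock E).mod}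
    (hT : T ∈ StarAlgebra.adjoin ℂ (⋃ i, Set.range (lambda E i)))
    {f : (E i).ksgns → fock E} (hf : f ∈ reducedMaps E i) :
    (fun m => T.1 (f m)) ∈ reducedMaps E i := by
  have hgen : ∀ (j : I) (a : A j) (f : (E i).ksgns → fock E), f ∈ reducedMaps E i →
      (fun m => (lambda E j a).1 (f m)) ∈ reducedMaps E i := by
    intro j a f hf
    induction hf using Submodule.span_induction with
    | mem f hf => exact hf.choose_spec.lambda_mem a
    | zero =>
      convert Submodule.zero_mem (reducedMaps E i) using 1
      exact funext fun m => map_zero _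
    | add f g _ _ hf hg =>
      convert Submodule.add_mem _ hf hg using 1
      exact funext fun m => map_add _ _ _
    | smul c f _ hf =>
      convert Submodule.smul_mem _ c hf using 1
      exact funext fun m => map_smul (lambda E j a).1 c (f m)
  rw [← StarSubalgebra.mem_toSubalgebra, StarAlgebra.adjoin_toSubalgebra] at hT
  induction hT using Algebra.adjoin_induction generalizing f with
  | mem T hT =>
    rcases hT with hT | hT
    · obtain ⟨j, a, rfl⟩ := Set.mem_iUnion.1 hT
      exact hgen j a f hf
    · obtain ⟨j, a, ha⟩ := Set.mem_iUnion.1 (Set.mem_star.1 hT)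
      obtain rfl : T = lambda E j (star a) := by rw [map_star, ha, star_star]
      exact hgen j _ f hf
  | algebraMap c => exact Submodule.smul_mem _ c hf
  | add S T _ _ hS hT => exact Submodule.add_mem _ (hS hf) (hT hf)
  | mul S T _ _ hS hT => exact hS (hT hf)

variable (E)

/-- `c` is the compression of `T` to `ξB ⊕ M°_i ≅ L²(A_i, E_i)`. -/
def IsCompression (i : I) (T : Adj (fock E).mod) (c : A i) : Prop :=
  ∀ m m' : (E i).ksgns,
    (fock E).mod.ip (vacFix E i m) (T.1 (vacFix E i m'))
      = (E i).ksgns.ip m (((E i).ksgnsRep c).1 m')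

variable {E}

lemma exists_ip_eq_of_mem_reducedMaps {i : I} {f : (E i).ksgns → fock E}
    (hf : f ∈ reducedMaps E i) : ∃ c : A i, ∀ m m' : (E i).ksgns,
      (fock E).mod.ip (vacFix E i m) (f m') = (E i).ksgns.ip m (((E i).ksgnsRep c).1 m') := by
  induction hf using Submodule.span_induction with
  | mem f hf =>
    obtain ⟨l, hf⟩ := hf
    by_cases hl : l = []
    · subst hl
      cases hf with
      | base c => exact ⟨c, fun m m' => ip_vacFix E i _ _⟩
    · refine ⟨0, fun m m' => (hf.ip_vacFix_eq_zero hl m m').trans ?_⟩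
      rw [map_zero]
      exact ((E i).ksgns.inner.zero_right m).symm
  | zero =>
    refine ⟨0, fun m m' => ((fock E).mod.inner.zero_right _).trans ?_⟩
    rw [map_zero]
    exact ((E i).ksgns.inner.zero_right m).symm
  | add f g _ _ hf hg =>
    obtain ⟨c, hc⟩ := hf
    obtain ⟨d, hd⟩ := hg
    refine ⟨c + d, fun m m' => ((fock E).mod.inner.add_right _ _ _).trans ?_⟩
    rw [map_add]
    exact (congrArg₂ _ (hc m m') (hd m m')).trans ((E i).ksgns.inner.add_right _ _ _).symm
  | smul z f _ hf =>
    obtain ⟨c, hc⟩ := hf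
    refine ⟨z • c, fun m m' => ((fock E).mod.inner.smul_right _ _ _).trans ?_⟩
    rw [map_smul]
    exact (congrArg _ (hc m m')).trans ((E i).ksgns.inner.smul_right _ _ _).symm

lemma exists_isCompression_of_mem_adjoin (i : I) {T : Adj (fock E).mod}
    (hT : T ∈ StarAlgebra.adjoin ℂ (⋃ i, Set.range (lambda E i))) :
    ∃ c, IsCompression E i T c := by
  have h := Submodule.subset_span (R := ℂ) (s := {f | ∃ l, ReducedMap E i l f})
    ⟨_, ReducedMap.base (1 : A i)⟩
  obtain ⟨c, hc⟩ := exists_ip_eq_of_mem_reducedMaps (adjoin_comp_mem_reducedMaps hT h)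
  refine ⟨c, fun m m' => ?_⟩
  rw [← hc m m', map_one]
  rfl

lemma IsCompression.sub {i : I} {S T : Adj (fock E).mod} {c d : A i}
    (hS : IsCompression E i S c) (hT : IsCompression E i T d) :
    IsCompression E i (S - T) (c - d) := fun m m' => by
  rw [map_sub]
  exact ((fock E).mod.inner.sub_right _ _ _).trans
    ((congrArg₂ _ (hS m m') (hT m m')).trans ((E i).ksgns.inner.sub_right _ _ _).symm)

lemma IsCompression.norm_le {i : I} (hE : IsFaithful (E i).map) {T : Adj (fock E).mod} {c : A i}
    (hT : IsCompression E i T c) : ‖c‖ ≤ ‖T‖ := by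
  rw [← (E i).norm_ksgnsRep hE c]
  refine ContinuousLinearMap.opNorm_le_bound _ (norm_nonneg _) fun m => ?_
  set n := ((E i).ksgnsRep c).1 m with hn
  have h1 : ‖n‖ * ‖n‖ ≤ ‖n‖ * (‖T‖ * ‖m‖) := by
    calc ‖n‖ * ‖n‖ = ‖(E i).ksgns.ip n n‖ := by rw [← pow_two, (E i).ksgns.norm_sq]
      _ = ‖(fock E).mod.ip (vacFix E i n) (T.1 (vacFix E i m))‖ := by rw [hT n m]
      _ ≤ ‖vacFix E i n‖ * ‖T.1 (vacFix E i m)‖ := (fock E).mod.norm_ip_le _ _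
      _ ≤ ‖vacFix E i n‖ * (‖T.1‖ * ‖vacFix E i m‖) := by
        gcongr; exact ContinuousLinearMap.le_opNorm _ _
      _ = ‖n‖ * (‖T‖ * ‖m‖) := by rw [norm_vacFix, norm_vacFix]; rfl
  rcases (norm_nonneg n).eq_or_lt with h | h
  · exact h.symm.le.trans (by positivity)
  · exact le_of_mul_le_mul_left h1 h

/-- The compression to `L²(A_i, E_i)` maps the reduced free product into `A_i`. -/
lemma exists_isCompression {i : I} (hE : IsFaithful (E i).map) {T : Adj (fock E).mod}
    (hT : T ∈ reducedFreeProduct E) : ∃ c, IsCompression E i T c := by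
  obtain ⟨t, ht, hlim⟩ := mem_closure_iff_seq_limit.1 hT
  choose c hc using fun n => exists_isCompression_of_mem_adjoin i (ht n)
  have hcauchy : CauchySeq c := by
    have h1 := Metric.cauchySeq_iff.1 hlim.cauchySeq
    refine Metric.cauchySeq_iff.2 fun ε hε => ?_
    obtain ⟨N, hN⟩ := h1 ε hε
    refine ⟨N, fun m hm n hn => ?_⟩
    have h2 := hN m hm n hn
    rw [dist_eq_norm] at h2 ⊢
    exact (((hc m).sub (hc n)).norm_le hE).trans_lt h2
  obtain ⟨d, hd⟩ := cauchySeq_tendsto_of_complete hcauchy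
  refine ⟨d, fun m m' => ?_⟩
  have hev : ∀ (X : HilbertModule.{u, max u w} B) (x y : X),
      Continuous fun S : Adj X => X.ip x (S.1 y) := fun X x y =>
    X.ip_continuous continuous_const
      ((ContinuousLinearMap.apply ℂ X y).continuous.comp continuous_subtype_val)
  have hev' : Continuous fun S : Adj (E i).ksgns => (E i).ksgns.ip m (S.1 m') :=
    (E i).ksgns.ip_continuous continuous_const
      ((ContinuousLinearMap.apply ℂ (E i).ksgns m').continuous.comp continuous_subtype_val)
  have hrep : Continuous (E i).ksgnsRep :=
    (AddMonoidHomClass.isometry_of_norm (E i).ksgnsRep ((E i).norm_ksgnsRep hE)).continuous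
  have h1 := ((hev (fock E).mod (vacFix E i m) (vacFix E i m')).tendsto T).comp hlim
  have h2 := ((hev'.comp hrep).tendsto d).comp hd
  exact tendsto_nhds_unique h1 (h2.congr fun n => (hc n m m').symm)

lemma lambda_mem_reducedFreeProduct (i : I) (a : A i) : lambda E i a ∈ reducedFreeProduct E :=
  StarSubalgebra.le_topologicalClosure _
    (StarAlgebra.subset_adjoin ℂ _ (Set.mem_iUnion.2 ⟨i, a, rfl⟩))

/-- An element of the free product that kills `ξ` also kills `λ_i(a) ξ`. -/
lemma apply_lambda_vacuum {i : I} (hE : IsFaithful (E i).map) {T : Adj (fock E).mod}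
    (hT : T ∈ reducedFreeProduct E) (h0 : T.1 (vacuum E) = 0) (a : A i) :
    T.1 ((lambda E i a).1 (vacuum E)) = 0 := by
  obtain ⟨c, hc⟩ := exists_isCompression hE (mul_mem (star_mem hT) hT)
  have hc0 : c = 0 := by
    refine hE c ?_
    have h := hc ((E i).hat c) (E i).ksgnsVec
    rw [vacFix_vec, Adj.mul_apply, h0, map_zero, CondExp.ksgnsVec, CondExp.ksgnsRep_hat, mul_one,
      CondExp.ip_hat] at h
    exact h.symm.trans ((fock E).mod.inner.zero_right _)
  subst hc0
  rw [lambda_vacuum]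
  have h := hc ((E i).hat a) ((E i).hat a)
  rw [Adj.mul_apply, Adj.ip_star_right, map_zero] at h
  exact (fock E).mod.eq_zero_of_ip_self (h.trans ((E i).ksgns.inner.zero_right _))

/-- The vector `ξ` is separating for the free product of faithful conditional expectations. -/
lemma eq_zero_of_apply_vacuum (hE : ∀ i, IsFaithful (E i).map) {T : Adj (fock E).mod}
    (hT : T ∈ reducedFreeProduct E) (h0 : T.1 (vacuum E) = 0) : T = 0 := by
  refine Subtype.ext (fock_clm_ext E fun ⟨k, hk⟩ x => ?_)
  change T.1 _ = 0
  induction k generalizing T with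
  | nil =>
    have h1 : ∀ b : B, wordIncl E ⟨[], hk⟩ b = op b • vacuum E := fun b => by
      refine Eq.trans ?_ (incl_rsmul (F := fun l : RedWord I => wordBimodule E l.1)
        ⟨[], hk⟩ (op b) (1 : B))
      exact congrArg (wordIncl E ⟨[], hk⟩) (one_mul (M := B) b).symm
    refine (congrArg T.1 (h1 x)).trans ?_
    rw [Adj.apply_rsmul, h0, smul_zero]
  | cons i k ih =>
    have hk' := List.isChain_cons.1 hk
    let l : WordNot i := ⟨⟨k, hk'.2⟩, hk'.1⟩
    refine consIncl_ind E l (S := {y | T.1 y = 0})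
      (isClosed_eq (ContinuousLinearMap.continuous _) continuous_const) (map_zero _)
      (fun x hx y hy => (map_add _ _ _).trans ((congrArg₂ _ hx hy).trans (add_zero _)))
      (fun z y => ?_) x
    have hvMap : ∀ m : (E i).ksgns,
        T.1 (vMap E i (tmul (N := fockNot E i) m (wordNotIncl E l y))) = 0 := by
      intro m
      induction m using CondExp.hat_ind with
      | hp =>
        exact isClosed_eq (T.1.continuous.comp ((vMap E i).continuous.comp
          (continuous_tmul_left (N := fockNot E i) (wordNotIncl E l y)))) continuous_const
      | h a =>
        have h1 := ih (mul_mem hT (lambda_mem_reducedFreeProduct i a))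
          (apply_lambda_vacuum (hE i) hT h0 a) hk'.2 y
        rw [← vMap_vec_tmul E l y, Adj.mul_apply] at h1
        rw [lambda_vMap, CondExp.ksgnsVec, CondExp.ksgnsRep_hat, mul_one] at h1
        exact h1
    have h1 := hvMap ((E i).circIncl z)
    rwa [vMap_circ_tmul] at h1

lemma freeE_star_mul_self (x : reducedFreeProduct E) : freeE E (star x * x)
    = (fock E).mod.ip (x.1.1 (vacuum E)) (x.1.1 (vacuum E)) :=
  Adj.ip_star_right x.1 _ _

lemma freeE_nonneg (x : reducedFreeProduct E) : 0 ≤ freeE E (star x * x) := by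
  rw [freeE_star_mul_self]
  exact (fock E).mod.inner.self_nonneg _

lemma apply_vacuum_of_freeE {x : reducedFreeProduct E} (hx : freeE E (star x * x) = 0) :
    x.1.1 (vacuum E) = 0 :=
   (fock E).mod.eq_zero_of_ip_self ((freeE_star_mul_self x).symm.trans hx)

end FaithfulFreeProduct
end FreeProd

theorem mainTheorem7 {I : Type w} [Nontrivial I]
    {B : Type u} [CStarAlgebra B] [PartialOrder B] [StarOrderedRing B]
    {A : I → Type u} [∀ i, CStarAlgebra (A i)] (E : ∀ i, FreeProd.CondExp B (A i)) :
    ((∀ i, FreeProd.IsFaithful (E i).map) → FreeProd.IsFaithful (FreeProd.freeE E)) ∧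
    (∀ (φB : B →ₗ[ℂ] ℂ) (φ : ∀ i, A i →ₗ[ℂ] ℂ),
      (∀ i, FreeProd.IsState (φ i)) →
      (∀ i a, φ i a = φ i ((E i).embed ((E i).map a))) →
      (∀ i b, φ i ((E i).embed b) = φB b) →
      (∀ i, FreeProd.IsFaithful (φ i)) →
      FreeProd.IsFaithful (φB ∘ₗ FreeProd.freeE E)) := by
  have hfree : (∀ i, FreeProd.IsFaithful (E i).map) → FreeProd.IsFaithful (FreeProd.freeE E) :=
    fun hE x hx => Subtype.ext (FreeProd.eq_zero_of_apply_vacuum hE x.2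
      (FreeProd.apply_vacuum_of_freeE hx))
  refine ⟨hfree, fun φB φ _ hφE hφB hφ x hx => ?_⟩
  refine hfree (fun i a ha => hφ i a ?_) x ?_
  · rw [hφE, ha, map_zero, map_zero]
  · obtain ⟨i⟩ := (inferInstance : Nonempty I)
    obtain ⟨c, hc⟩ := CStarAlgebra.nonneg_iff_eq_star_mul_self.1 (FreeProd.freeE_nonneg x)
    have h1 : φB (star c * c) = 0 := by
      rw [← hc]
      exact hx
    have h2 : (E i).embed c = 0 := hφ i _ (by rw [← map_star, ← map_mul, hφB, h1])
    have h3 := (E i).map_embed c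
    rw [h2, map_zero] at h3
    rw [hc, ← h3, mul_zero]
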